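/- Multi-valued functions are identified with the sets of their choice functions (partial functions whose domain is the domain of the multi-valued function). For multi-valued functions $A$, $B$ between topological spaces, $A \le_2 B$ means that there are continuous partial functions $F$, $G$ such that the partial function $w \mapsto F(w, g(G(w)))$ belongs to $A$ for each $g \in B$; $A <_2 B$ means $A \le_2 B$ and $B \nleq_2 A$. The Baire space $\mathbb{N}^{\mathbb{N}}$ carries the product topology. Let $\nu : \mathbb{N} \to \mathbb{Q}$ be a bijection; $w \in \mathbb{N}^{\mathbb{N}}$ is a name of $x \in \mathbb{R}$ if $|\nu(w(i)) - x| \le 2^{-i}$ for all $i$. Finite tuples of sequences are coded into one sequence by interleaving. A name of an $n \times m$ bi-matrix game $(A,B)$, $n, m \ge 1$, is a sequence $0^n1^m0\langle w^a, w^b\rangle$, where $w^a$, $w^b$ code the tuples (column by column) of names of the entries of $A$, $B$; a name of a pair $(x, y)$ of mixed strategies, i.e. of probability vectors $x \in \mathbb{R}^n$, $y \in \mathbb{R}^m$, is a sequence $0^n1^m0\langle w^x, w^y\rangle$, where $w^x$, $w^y$ code the tuples of names of the coefficients. Let $\textsc{Nash}$ be the multi-valued function whose choice functions are the functions that map every name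 of a bi-matrix game (of arbitrary size) to some name of a Nash equilibrium of that game. Let $Sep$ be the multi-valued function whose choice functions are the functions $f$ from $\{(p,q) \in \mathbb{N}^{\mathbb{N}} \times \mathbb{N}^{\mathbb{N}} \mid \forall n, m\ p(n) \ne q(m)\}$ to $\mathbb{N}^{\mathbb{N}}$ with $f(p,q)(p(n)) = 0$ and $f(p,q)(q(n)) = 1$ for all $n$. Then $$\textsc{Nash} <_2 Sep,$$ that is, $\textsc{Nash} \le_2 Sep$ and $Sep \nleq_2 \textsc{Nash}$. -/

import Mathlib

namespace NashSep

/-! Multi-valued functions are identified with the sets of their choice functions, which are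
partial functions having the domain of the multi-valued function. -/

/-- Continuity of a partial function: as a function on its domain (any subset of `X`),
with the subspace topology. -/
def PartialContinuous {X Y : Type*} [TopologicalSpace X] [TopologicalSpace Y]
    (f : X →. Y) : Prop :=
  Continuous f.asSubtype

/-- The partial function `w ↦ F (w, g (G w))`, defined exactly where all of
`G w`, `g (G w)` and `F (w, g (G w))` are. -/
def sandwich {X Y U V : Type*} (F : X × V →. Y) (G : X →. U) (g : U →. V) : X →. Y :=
  fun w => (G w).bind fun u => (g u).bind fun v => F (w, v)

/-- Type-2 reducibility of multi-valued functions (as sets of choice functions). -/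
def Type2Reducible {X Y U V : Type*} [TopologicalSpace X] [TopologicalSpace Y]
    [TopologicalSpace U] [TopologicalSpace V] (A : Set (X →. Y)) (B : Set (U →. V)) : Prop :=
  ∃ (F : X × V →. Y) (G : X →. U), PartialContinuous F ∧ PartialContinuous G ∧
    ∀ g ∈ B, sandwich F G g ∈ A

/-- Strict Type-2 reducibility. -/
def StrictlyType2Reducible {X Y U V : Type*} [TopologicalSpace X] [TopologicalSpace Y]
    [TopologicalSpace U] [TopologicalSpace V] (A : Set (X →. Y)) (B : Set (U →. V)) : Prop :=
  Type2Reducible A B ∧ ¬ Type2Reducible B A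

/-- The problem of separating two disjoint enumerated sets of natural numbers. -/
def Sep : Set ((ℕ → ℕ) × (ℕ → ℕ) →. (ℕ → ℕ)) :=
  {f | f.Dom = {pq | ∀ n m, pq.1 n ≠ pq.2 m} ∧
    ∀ p q, ∀ s ∈ f (p, q), ∀ n, s (p n) = 0 ∧ s (q n) = 1}

/-- The representation of the reals: `w` is a name of `x` with respect to the numbering `ν` of
the rationals. -/
def IsRealName (ν : ℕ → ℚ) (w : ℕ → ℕ) (x : ℝ) : Prop :=
  ∀ i : ℕ, |(ν (w i) : ℝ) - x| ≤ (2 : ℝ)⁻¹ ^ i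

/-- The `j`-th component (counted from `0`, `j < k`) of a sequence read as an interleaved
`k`-tuple of sequences. -/
def component (k j : ℕ) (w : ℕ → ℕ) : ℕ → ℕ := fun i => w (k * i + j)

/-- The sequence `0ⁿ 1ᵐ 0 w`. -/
def withSize (n m : ℕ) (w : ℕ → ℕ) : ℕ → ℕ := fun i =>
  if i < n then 0 else if i < n + m then 1 else if i = n + m then 0 else w (i - (n + m + 1))

/-- Names of `n × m` bi-matrix games: the size, followed by the pair of the two tuples of names
of matrix entries, each listed column by column. -/
def IsGameName (ν : ℕ → ℚ) {n m : ℕ} (w : ℕ → ℕ) (A B : Matrix (Fin n) (Fin m) ℝ) : Prop :=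
  ∃ w₂ : ℕ → ℕ, w = withSize n m w₂ ∧ ∀ (i : Fin n) (j : Fin m),
    IsRealName ν (component (n * m) (j * n + i) (component 2 0 w₂)) (A i j) ∧
    IsRealName ν (component (n * m) (j * n + i) (component 2 1 w₂)) (B i j)

/-- Names of pairs of mixed strategies: the sizes, followed by the pair of the two tuples of
names of the coefficients. -/
def IsStrategyPairName (ν : ℕ → ℚ) {n m : ℕ} (w : ℕ → ℕ) (x : Fin n → ℝ) (y : Fin m → ℝ) :
    Prop :=
  ∃ w₂ : ℕ → ℕ, w = withSize n m w₂ ∧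
    (∀ i : Fin n, IsRealName ν (component n i (component 2 0 w₂)) (x i)) ∧
    (∀ j : Fin m, IsRealName ν (component m j (component 2 1 w₂)) (y j))

/-- Nash equilibria of the bi-matrix game `(A, B)`, in mixed strategies. -/
def IsNashEquilibrium {n m : ℕ} (A B : Matrix (Fin n) (Fin m) ℝ)
    (x : Fin n → ℝ) (y : Fin m → ℝ) : Prop :=
  x ∈ stdSimplex ℝ (Fin n) ∧ y ∈ stdSimplex ℝ (Fin m) ∧
    (∀ x' ∈ stdSimplex ℝ (Fin n), x' ⬝ᵥ A.mulVec y ≤ x ⬝ᵥ A.mulVec y) ∧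
    (∀ y' ∈ stdSimplex ℝ (Fin m), x ⬝ᵥ B.mulVec y' ≤ x ⬝ᵥ B.mulVec y)

/-- The problem of finding a Nash equilibrium of a bi-matrix game of any size
(at least one strategy for each player), on names. -/
def Nash (ν : ℕ → ℚ) : Set ((ℕ → ℕ) →. (ℕ → ℕ)) :=
  {f | f.Dom = {w | ∃ n m : ℕ, 0 < n ∧ 0 < m ∧
      ∃ A B : Matrix (Fin n) (Fin m) ℝ, IsGameName ν w A B} ∧
    ∀ (n m : ℕ), 0 < n → 0 < m → ∀ (A B : Matrix (Fin n) (Fin m) ℝ) (w : ℕ → ℕ),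
      IsGameName ν w A B → ∀ v ∈ f w, ∃ (x : Fin n → ℝ) (y : Fin m → ℝ),
        IsNashEquilibrium A B x y ∧ IsStrategyPairName ν v x y}

end NashSep

/-!
**Nash ≤ Sep.** The mixed strategies of an `n × m` game form a compact metric space, hence a
continuous image of the Cantor space, and whether a point of the Cantor space represents a Nash
equilibrium of a named game is a closed condition. Separation selects a point from a nonempty closed
subset of the Cantor space (`path_of_separates`): by compactness, a binary string that does not
extend to a point of the set is recognized from finitely many terms of the input, so one can
enumerate separately the strings whose left or right successor is recognized first, and a separating
sequence leads along a branch of extendable strings.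

That the sets of equilibria are nonempty is Nash's theorem, which is proved here. A point of the
simplex whose support lies in the set of best responses to it (a symmetric equilibrium) exists by a
covering theorem of Knaster–Kuratowski–Mazurkiewicz type
(`exists_mem_of_closed_cover_stdSimplex`), which follows by compactness from Scarf's combinatorial
lemma (`exists_isDominating_image_eq_univ`), a parity count of dominating sets. Playing both roles
of a bi-matrix game with positive payoffs is a symmetric game, whose symmetric equilibria split into
the two strategies of a Nash equilibrium (`IsSymmetricEquilibrium.isNashEquilibrium`).

**Sep ≰ Nash.** Among the symmetric equilibria of a matrix, one with the greatest number of tight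
inequalities is determined by the set of these inequalities
(`IsExtremeEquilibrium.eq_of_subset`). Hence, on each of finitely many pieces, an equilibrium is
given by a closed relation with unique solutions in a compact set, so it depends continuously on the
matrix. Thus names of Nash equilibria are found continuously on countably many pieces
(`exists_piecewise_continuous_nash`), and a reduction would transfer this to `Sep`. But a
diagonalization yields an instance of `Sep` at which countably many continuous functions all fail
(`exists_disjoint_notMem`).
-/

namespace NashSep

open Matrix Topology Filter PiNat

/-! ### Scarf's lemma -/

/-- A finite set `σ` of points is dominating for the orders on `T` given by the functions `f i` if
no point of `T` lies strictly above all the lower bounds `min_σ (f i)`. -/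
def IsDominating {T I : Type*} (f : I → T → ℕ) (σ : Finset T) : Prop :=
  ∀ y, ∃ i, ∀ x ∈ σ, f i y ≤ f i x

section Scarf

variable {T I : Type*} {f : I → T → ℕ} {τ : Finset T} {g : I → T}

theorem IsDominating.mono {σ : Finset T} (h : IsDominating f σ) (hs : τ ⊆ σ) :
    IsDominating f τ := fun y => (h y).imp fun _ hi x hx => hi x (hs hx)

/-- In a dominating set, each point is the minimum of some order. -/
theorem IsDominating.exists_eq (hf : ∀ i, Function.Injective (f i)) (hg : ∀ i, g i ∈ τ)
    (hmin : ∀ i, ∀ x ∈ τ, f i (g i) ≤ f i x) (h : IsDominating f τ) {x : T} (hx : x ∈ τ) :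
    ∃ i, g i = x := by
  obtain ⟨i, hi⟩ := h x
  exact ⟨i, hf i (le_antisymm (hmin i x hx) (hi _ (hg i)))⟩

open Classical in
theorem card_filter_isMax [Fintype T] {h : T → ℕ} (hh : Function.Injective h) (S : Set T) :
    (Finset.univ.filter fun y => y ∈ S ∧ ∀ z ∈ S, h z ≤ h y).card =
      if S.Nonempty then 1 else 0 := by
  split_ifs with hS
  · obtain ⟨y, hy, hmax⟩ := Set.exists_max_image S h S.toFinite hS
    rw [Finset.card_eq_one]
    refine ⟨y, ?_⟩
    ext x
    simp only [Finset.mem_filter, Finset.mem_univ, true_and, Finset.mem_singleton]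
    constructor
    · exact fun ⟨h1, h2⟩ => hh (le_antisymm (hmax x h1) (h2 y hy))
    · rintro rfl
      exact ⟨hy, hmax⟩
  · rw [Finset.card_eq_zero, Finset.filter_eq_empty_iff]
    exact fun y _ h1 => hS ⟨y, h1.1⟩

variable [Fintype I] [DecidableEq I] [DecidableEq T]

/-- A dominating set with one point less than there are orders has exactly one pair of orders with
a common minimum. -/
theorem IsDominating.exists_pair (hf : ∀ i, Function.Injective (f i)) (hg : ∀ i, g i ∈ τ)
    (hmin : ∀ i, ∀ x ∈ τ, f i (g i) ≤ f i x) (h : IsDominating f τ)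
    (hcard : τ.card + 1 = Fintype.card I) :
    ∃ i j, i ≠ j ∧ g i = g j ∧ (∀ k, k = i ∨ k = j → ∀ x ∈ τ, ∃ l, l ≠ k ∧ g l = x) ∧
      ∀ k, k ≠ i → k ≠ j → ∀ l, g l = g k → l = k := by
  obtain ⟨i, -, j, -, hij, hgij⟩ := Finset.exists_ne_map_eq_of_card_lt_of_maps_to
    (s := (Finset.univ : Finset I)) (t := τ) (f := g)
    (by rw [Finset.card_univ]; omega) (fun i _ => hg i)
  have hsurj : ∀ k, k = i ∨ k = j → ∀ x ∈ τ, ∃ l, l ≠ k ∧ g l = x := by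
    intro k hk x hx
    obtain ⟨l, rfl⟩ := h.exists_eq hf hg hmin hx
    rcases eq_or_ne l k with rfl | hne
    · rcases hk with rfl | rfl
      · exact ⟨j, hij.symm, hgij.symm⟩
      · exact ⟨i, hij, hgij⟩
    · exact ⟨l, hne, rfl⟩
  have himg : (Finset.univ.erase i).image g = τ := by
    ext x
    simp only [Finset.mem_image, Finset.mem_erase, Finset.mem_univ, and_true]
    exact ⟨fun ⟨l, _, hl⟩ => hl ▸ hg l, fun hx => hsurj i (Or.inl rfl) x hx⟩
  have hinj : Set.InjOn g (Finset.univ.erase i : Finset I) := by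
    rw [← Finset.card_image_iff, himg, Finset.card_erase_of_mem (Finset.mem_univ i),
      Finset.card_univ]
    omega
  refine ⟨i, j, hij, hgij, hsurj, fun k hki hkj l hl => ?_⟩
  by_cases hli : l = i
  · exact absurd (hinj (by simpa using hij.symm) (by simpa using hki)
      (by rw [← hgij, ← hl, hli])) (Ne.symm hkj)
  · exact hinj (by simpa using hli) (by simpa using hki) hl

/-- The points that lie strictly above `τ` (whose minima are the `g l`) in all orders but the
`k`-th one. -/
def upperPoints (f : I → T → ℕ) (g : I → T) (k : I) : Set T :=
  {y | ∀ l, l ≠ k → f l (g l) < f l y}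

/-- The pivoting step: the points by which `τ` can be completed to a larger dominating set are
the `k`-maxima of `upperPoints f g k`, where `k` is one of the two orders with a common minimum. -/
theorem IsDominating.insert_iff (hf : ∀ i, Function.Injective (f i)) (hg : ∀ i, g i ∈ τ)
    (hmin : ∀ i, ∀ x ∈ τ, f i (g i) ≤ f i x) (h : IsDominating f τ)
    (hcard : τ.card + 1 = Fintype.card I) {i j : I}
    (hsurj : ∀ k, k = i ∨ k = j → ∀ x ∈ τ, ∃ l, l ≠ k ∧ g l = x)
    (hinj : ∀ k, k ≠ i → k ≠ j → ∀ l, g l = g k → l = k) (y : T) :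
    (y ∉ τ ∧ IsDominating f (insert y τ)) ↔
      ∃ k, (k = i ∨ k = j) ∧ y ∈ upperPoints f g k ∧ ∀ z ∈ upperPoints f g k, f k z ≤ f k y := by
  constructor
  · rintro ⟨hy, hd⟩
    have hne : (insert y τ).Nonempty := Finset.insert_nonempty _ _
    choose g' hg' hmin' using fun i => Finset.exists_min_image (insert y τ) (f i) hne
    have himg : Finset.univ.image g' = insert y τ := by
      ext x
      simp only [Finset.mem_image, Finset.mem_univ, true_and]
      exact ⟨fun ⟨l, hl⟩ => hl ▸ hg' l, fun hx => hd.exists_eq hf hg' hmin' hx⟩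
    have hinj' : Set.InjOn g' (Finset.univ : Finset I) := by
      rw [← Finset.card_image_iff, himg, Finset.card_insert_of_notMem hy, Finset.card_univ, hcard]
    obtain ⟨k, hk⟩ := hd.exists_eq hf hg' hmin' (Finset.mem_insert_self y τ)
    have heq : ∀ l, l ≠ k → g' l = g l := by
      intro l hl
      have hly : g' l ≠ y := fun hh => hl (hinj' (by simp) (by simp) (hh.trans hk.symm))
      have hlt : g' l ∈ τ := (Finset.mem_insert.1 (hg' l)).resolve_left hly
      exact hf l (le_antisymm (hmin' l _ (Finset.mem_insert_of_mem (hg l))) (hmin l _ hlt))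
    have hup : y ∈ upperPoints f g k := by
      intro l hl
      have h1 := hmin' l y (Finset.mem_insert_self y τ)
      rw [heq l hl] at h1
      exact lt_of_le_of_ne h1 fun hh => hy (hf l hh ▸ hg l)
    refine ⟨k, ?_, hup, fun z hz => ?_⟩
    · by_contra hcon
      push Not at hcon
      obtain ⟨l, hl⟩ := hd.exists_eq hf hg' hmin' (Finset.mem_insert_of_mem (hg k))
      rcases eq_or_ne l k with rfl | hne
      · exact hy (hk ▸ hl ▸ hg l)
      · exact hne (hinj k hcon.1 hcon.2 l ((heq l hne).symm.trans hl))
    · obtain ⟨l, hl⟩ := hd z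
      rcases eq_or_ne l k with rfl | hne
      · exact hl y (Finset.mem_insert_self y τ)
      · exact absurd (hz l hne) (not_lt.2 (hl _ (Finset.mem_insert_of_mem (hg l))))
  · rintro ⟨k, hk, hup, hmax⟩
    have hy : y ∉ τ := by
      intro hy
      obtain ⟨l, hl, rfl⟩ := hsurj k hk y hy
      exact lt_irrefl _ (hup l hl)
    refine ⟨hy, fun z => ?_⟩
    by_cases hz : z ∈ upperPoints f g k
    · refine ⟨k, fun x hx => (hmax z hz).trans ?_⟩
      rcases Finset.mem_insert.1 hx with rfl | hx
      · exact le_rfl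
      · obtain ⟨l, hl⟩ := h y
        rcases eq_or_ne l k with rfl | hne
        · exact hl x hx
        · exact absurd (hup l hne) (not_lt.2 (hl _ (hg l)))
    · simp only [upperPoints, Set.mem_ofPred_eq, not_forall, not_lt] at hz
      obtain ⟨l, hl, hzl⟩ := hz
      refine ⟨l, fun x hx => ?_⟩
      rcases Finset.mem_insert.1 hx with rfl | hx
      · exact hzl.trans (hup l hl).le
      · exact hzl.trans (hmin l x hx)

open Classical in
/-- The completions of a dominating set by one point are counted by the two orders with a common
minimum; each contributes a completion unless no point lies above the set in all other orders. -/
theorem IsDominating.card_completions [Fintype T] (hf : ∀ i, Function.Injective (f i))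
    (hg : ∀ i, g i ∈ τ)
    (hmin : ∀ i, ∀ x ∈ τ, f i (g i) ≤ f i x) (h : IsDominating f τ)
    (hcard : τ.card + 1 = Fintype.card I) {i j : I} (hij : i ≠ j)
    (hsurj : ∀ k, k = i ∨ k = j → ∀ x ∈ τ, ∃ l, l ≠ k ∧ g l = x)
    (hinj : ∀ k, k ≠ i → k ≠ j → ∀ l, g l = g k → l = k) :
    (Finset.univ.filter fun y => y ∉ τ ∧ IsDominating f (insert y τ)).card =
      (if (upperPoints f g i).Nonempty then 1 else 0) +
      (if (upperPoints f g j).Nonempty then 1 else 0) := by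
  rw [← card_filter_isMax (hf i), ← card_filter_isMax (hf j), ← Finset.card_union_of_disjoint]
  · congr 1
    ext y
    rw [Finset.mem_union]
    simp only [Finset.mem_filter, Finset.mem_univ, true_and]
    rw [h.insert_iff hf hg hmin hcard hsurj hinj]
    constructor
    · rintro ⟨k, rfl | rfl, hk⟩
      · exact Or.inl hk
      · exact Or.inr hk
    · rintro (hk | hk)
      · exact ⟨i, Or.inl rfl, hk⟩
      · exact ⟨j, Or.inr rfl, hk⟩
  · rw [Finset.disjoint_left]
    intro y hy hy'
    simp only [Finset.mem_filter, Finset.mem_univ, true_and] at hy hy'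
    obtain ⟨l, hl⟩ := h y
    have : f l (g l) < f l y := by
      rcases eq_or_ne l i with rfl | hne
      · exact hy'.1 l hij
      · exact hy.1 l hne
    exact absurd this (not_lt.2 (hl _ (hg l)))

variable {e : I → T} {c : T → I} {i₀ : I}

/-- A set bearing all colours but `i₀` whose `l`-th minimum is the slack point of another order
is the set of all slack points but `e i₀`. -/
theorem eq_image_erase_of_min_slack (hslack : ∀ i j t, t ∉ Set.range e → j ≠ i → f j t < f j (e i))
    (hmin : ∀ i, ∀ x ∈ τ, f i (g i) ≤ f i x)
    (hc : ∀ i, c (e i) = i)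
    (hτ : τ.image c = Finset.univ.erase i₀)
    {l p : I} (hpl : l ≠ p) (hl : g l = e p) : τ = (Finset.univ.erase i₀).image e := by
  have hall : ∀ t ∈ τ, t ∈ Set.range e := by
    intro t ht
    by_contra hcon
    have h1 := hslack p l t hcon hpl
    have h2 := hmin l t ht
    rw [hl] at h2
    omega
  ext t
  constructor
  · intro ht
    obtain ⟨q, rfl⟩ := hall t ht
    refine Finset.mem_image_of_mem e ?_
    rw [← hτ, Finset.mem_image]
    exact ⟨e q, ht, hc q⟩
  · intro ht
    obtain ⟨q, hq, rfl⟩ := Finset.mem_image.1 ht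
    rw [← hτ, Finset.mem_image] at hq
    obtain ⟨s, hs, rfl⟩ := hq
    obtain ⟨r, rfl⟩ := hall s hs
    rwa [hc]

open Classical in
/-- Facets bearing all colours but `i₀` have zero or two completions to a dominating set, except
for the facet of slack points. -/
theorem even_card_completions [Fintype T] [Nontrivial I]
    (hslack : ∀ i j t, t ∉ Set.range e → j ≠ i → f j t < f j (e i))
    (hle : ∀ i t, f i (e i) ≤ f i t)
    (hf : ∀ i, Function.Injective (f i)) (hc : ∀ i, c (e i) = i)
    (hτ : τ.image c = Finset.univ.erase i₀)
    (hcard : τ.card + 1 = Fintype.card I) (hne : τ ≠ (Finset.univ.erase i₀).image e) :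
    2 ∣ (Finset.univ.filter fun y => y ∉ τ ∧ IsDominating f (insert y τ)).card := by
  by_cases h : IsDominating f τ
  swap
  · rw [Finset.filter_eq_empty_iff.2 fun y _ hy => h (hy.2.mono (Finset.subset_insert _ _))]
    simp
  have hτne : τ.Nonempty := by
    rw [← Finset.card_pos]
    have := Fintype.one_lt_card (α := I)
    omega
  choose g hg hmin using fun i => Finset.exists_min_image τ (f i) hτne
  obtain ⟨i, j, hij, -, hsurj, hinj⟩ := h.exists_pair hf hg hmin hcard
  -- Each `l`-th minimum is an ordinary point or `e l`, and `e k` lies above these.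
  have hup : ∀ k, e k ∈ upperPoints f g k := by
    intro k l hl
    refine lt_of_le_of_ne ?_ fun hh => ?_
    · by_cases hr : g l ∈ Set.range e
      · obtain ⟨p, hp⟩ := hr
        rcases eq_or_ne l p with rfl | hlp
        · rw [← hp]
          exact hle l _
        · exact absurd (eq_image_erase_of_min_slack hslack hmin hc hτ hlp hp.symm) hne
      · exact (hslack k l _ hr hl).le
    · exact hne (eq_image_erase_of_min_slack hslack hmin hc hτ hl (hf l hh))
  rw [h.card_completions hf hg hmin hcard hij hsurj hinj, if_pos ⟨_, hup i⟩, if_pos ⟨_, hup j⟩]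

open Classical in
/-- The facet of all slack points but one has exactly one completion to a dominating set: of the
two orders with a common minimum, only the `i₀`-th one has points above the facet in all others. -/
theorem card_completions_slack [Fintype T] [Nontrivial I]
    (hslack : ∀ i j t, t ∉ Set.range e → j ≠ i → f j t < f j (e i))
    (hle : ∀ i t, f i (e i) ≤ f i t)
    (hf : ∀ i, Function.Injective (f i)) (hc : ∀ i, c (e i) = i)
    (hτ : τ = (Finset.univ.erase i₀).image e) {t₀ : T} (ht₀ : t₀ ∉ Set.range e) :
    (Finset.univ.filter fun y => y ∉ τ ∧ IsDominating f (insert y τ)).card = 1 := by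
  have heinj : Function.Injective e := fun i j hij => by rw [← hc i, hij, hc]
  have hcard : τ.card + 1 = Fintype.card I := by
    rw [hτ, Finset.card_image_of_injective _ heinj, Finset.card_erase_of_mem (Finset.mem_univ _),
      Finset.card_univ]
    have := Fintype.one_lt_card (α := I)
    omega
  have hτne : τ.Nonempty := by
    rw [← Finset.card_pos]
    have := Fintype.one_lt_card (α := I)
    omega
  choose g hg hmin using fun i => Finset.exists_min_image τ (f i) hτne
  have hmem : ∀ p, p ≠ i₀ → e p ∈ τ := fun p hp => by
    rw [hτ]; exact Finset.mem_image_of_mem e (by simpa using hp)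
  have hg' : ∀ p, p ≠ i₀ → g p = e p := fun p hp =>
    hf p (le_antisymm (hmin p _ (hmem p hp)) (hle p _))
  obtain ⟨q, hq, hgq⟩ : ∃ q, q ≠ i₀ ∧ g i₀ = e q := by
    have := hg i₀
    rw [hτ, Finset.mem_image] at this
    obtain ⟨q, hq, h⟩ := this
    exact ⟨q, by simpa using hq, h.symm⟩
  have hnot : ∀ y, y ∉ Set.range e → f i₀ y < f i₀ (g i₀) := fun y hy => by
    rw [hgq]; exact hslack q i₀ y hy hq.symm
  have h : IsDominating f τ := by
    intro y
    by_cases hy : y ∈ Set.range e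
    · obtain ⟨l, rfl⟩ := hy
      exact ⟨l, fun x _ => hle l x⟩
    · exact ⟨i₀, fun x hx => (hnot y hy).le.trans (hmin i₀ x hx)⟩
  have hsurj : ∀ k, k = i₀ ∨ k = q → ∀ x ∈ τ, ∃ l, l ≠ k ∧ g l = x := by
    intro k hk x hx
    obtain ⟨p, hp, rfl⟩ := Finset.mem_image.1 (hτ ▸ hx)
    have hp' : p ≠ i₀ := by simpa using hp
    rcases hk with rfl | rfl
    · exact ⟨p, hp', hg' p hp'⟩
    · rcases eq_or_ne p k with rfl | hpk
      · exact ⟨i₀, hq.symm, hgq⟩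
      · exact ⟨p, hpk, hg' p hp'⟩
  have hinj : ∀ k, k ≠ i₀ → k ≠ q → ∀ l, g l = g k → l = k := by
    intro k hk hkq l hl
    rw [hg' k hk] at hl
    rcases eq_or_ne l i₀ with rfl | hne
    · exact absurd (heinj (hl.symm.trans hgq)) hkq
    · rw [hg' l hne] at hl
      exact heinj hl
  rw [h.card_completions hf hg hmin hcard hq.symm hsurj hinj, if_pos, if_neg]
  · rintro ⟨y, hy⟩
    by_cases hr : y ∈ Set.range e
    · obtain ⟨r, rfl⟩ := hr
      by_cases hri : r = i₀
      · subst hri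
        exact absurd (hy r hq.symm) (not_lt.2 (hle _ _))
      · by_cases hrq : r = q
        · subst hrq
          exact lt_irrefl _ (hgq ▸ hy i₀ (Ne.symm hri))
        · have := hy r hrq
          rw [hg' r hri] at this
          exact lt_irrefl _ this
    · exact absurd (hy i₀ hq.symm) (not_lt.2 (hnot y hr).le)
  · refine ⟨t₀, fun l hl => lt_of_le_of_ne ?_ fun hh => ?_⟩
    · rw [hg' l hl]
      exact hle l _
    · rw [hg' l hl] at hh
      exact ht₀ ⟨l, hf l hh⟩

/-- A set that misses some colour has an even number of facets bearing all colours but `i₀`. -/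
theorem even_card_facets {σ : Finset T} (hcard : σ.card = Fintype.card I)
    (hσ : σ.image c ≠ Finset.univ) :
    2 ∣ (σ.filter fun x => (σ.erase x).image c = Finset.univ.erase i₀).card := by
  rcases Finset.eq_empty_or_nonempty
    (σ.filter fun x => (σ.erase x).image c = Finset.univ.erase i₀) with h | ⟨x, hx⟩
  · rw [h]
    simp
  rw [Finset.mem_filter] at hx
  obtain ⟨hxσ, hx⟩ := hx
  have hcx : c x ≠ i₀ := by
    intro hcx
    apply hσ
    rw [← Finset.insert_erase hxσ, Finset.image_insert, hx, hcx,
      Finset.insert_erase (Finset.mem_univ _)]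
  obtain ⟨x', hx', hcx'⟩ : ∃ x' ∈ σ.erase x, c x' = c x := by
    rw [← Finset.mem_image, hx]
    simpa using hcx
  have hinj : Set.InjOn c (σ.erase x : Finset T) := by
    rw [← Finset.card_image_iff, hx, Finset.card_erase_of_mem hxσ,
      Finset.card_erase_of_mem (Finset.mem_univ _), hcard, Finset.card_univ]
  have hxx' : x ≠ x' := fun h => by simp [h] at hx'
  have hx'σ := Finset.mem_of_mem_erase hx'
  have : (σ.filter fun x => (σ.erase x).image c = Finset.univ.erase i₀) = {x, x'} := by
    ext z
    rw [Finset.mem_filter, Finset.mem_insert, Finset.mem_singleton]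
    constructor
    · rintro ⟨hz, hzi⟩
      by_contra hcon
      push Not at hcon
      have hzm : c z ∈ (σ.erase z).image c := by
        rw [hzi, ← hx]
        exact Finset.mem_image_of_mem c (Finset.mem_erase.2 ⟨hcon.1, hz⟩)
      obtain ⟨y, hy, hyz⟩ := Finset.mem_image.1 hzm
      obtain ⟨hyz', hyσ⟩ := Finset.mem_erase.1 hy
      by_cases hyx : y = x
      · subst hyx
        exact hcon.2 (hinj (by simp [hz, hcon.1]) hx' (hyz.symm.trans hcx'.symm))
      · exact hyz' (hinj (by simp [hyx, hyσ]) (by simp [hz, hcon.1]) hyz)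
    · rintro (rfl | rfl)
      · exact ⟨hxσ, hx⟩
      · refine ⟨hx'σ, ?_⟩
        rw [← hx]
        ext k
        simp only [Finset.mem_image, Finset.mem_erase]
        constructor
        · rintro ⟨a, ⟨ha, haσ⟩, rfl⟩
          by_cases hax : a = x
          · exact ⟨z, ⟨hxx'.symm, hx'σ⟩, by rw [hax, hcx']⟩
          · exact ⟨a, ⟨hax, haσ⟩, rfl⟩
        · rintro ⟨a, ⟨ha, haσ⟩, rfl⟩
          by_cases hax : a = z
          · exact ⟨x, ⟨hxx', hxσ⟩, by rw [hax, hcx']⟩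
          · exact ⟨a, ⟨hax, haσ⟩, rfl⟩
  rw [this, Finset.card_pair hxx']

/-- **Scarf's lemma.** If `T` contains for every order a slack point `e i`, which is the least
point of the `i`-th order and lies above all ordinary points in the other orders, then every
colouring of `T` with `c (e i) = i` has a dominating set bearing all colours. -/
theorem exists_isDominating_image_eq_univ [Fintype T] [Nontrivial I]
    (hslack : ∀ i j t, t ∉ Set.range e → j ≠ i → f j t < f j (e i))
    (hle : ∀ i t, f i (e i) ≤ f i t)
    (hf : ∀ i, Function.Injective (f i)) (hc : ∀ i, c (e i) = i)
    {t₀ : T} (ht₀ : t₀ ∉ Set.range e) :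
    ∃ σ : Finset T, IsDominating f σ ∧ σ.image c = Finset.univ := by
  classical
  by_contra hcon
  push Not at hcon
  obtain ⟨i₀⟩ : Nonempty I := inferInstance
  have heinj : Function.Injective e := fun i j hij => by rw [← hc i, hij, hc]
  let doors : Finset (Finset T) := Finset.univ.filter fun τ =>
    τ.card + 1 = Fintype.card I ∧ τ.image c = Finset.univ.erase i₀
  let rooms : Finset (Finset T) := Finset.univ.filter fun σ =>
    σ.card = Fintype.card I ∧ IsDominating f σ
  let up : Finset T → Finset T := fun τ =>
    Finset.univ.filter fun y => y ∉ τ ∧ IsDominating f (insert y τ)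
  let down : Finset T → Finset T := fun σ =>
    σ.filter fun x => (σ.erase x).image c = Finset.univ.erase i₀
  -- Pairs of a facet and a completion of it are pairs of a set and a point to delete from it.
  have hcount : (doors.sigma fun τ => up τ).card = (rooms.sigma fun σ => down σ).card := by
    refine Finset.card_nbij' (fun p => ⟨insert p.2 p.1, p.2⟩) (fun p => ⟨p.1.erase p.2, p.2⟩)
      ?_ ?_ ?_ ?_
    · rintro ⟨τ, y⟩ h
      simp only [doors, rooms, up, down, Finset.coe_sigma, Set.mem_sigma_iff, Finset.mem_coe,
        Finset.mem_filter, Finset.mem_univ, true_and] at h ⊢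
      obtain ⟨⟨h1, h2⟩, h3, h4⟩ := h
      refine ⟨⟨by rw [Finset.card_insert_of_notMem h3, h1], h4⟩, Finset.mem_insert_self _ _, ?_⟩
      rw [Finset.erase_insert h3, h2]
    · rintro ⟨σ, x⟩ h
      simp only [doors, rooms, up, down, Finset.coe_sigma, Set.mem_sigma_iff, Finset.mem_coe,
        Finset.mem_filter, Finset.mem_univ, true_and] at h ⊢
      obtain ⟨⟨h1, h2⟩, h3, h4⟩ := h
      refine ⟨⟨by rw [Finset.card_erase_add_one h3, h1], h4⟩, Finset.notMem_erase _ _, ?_⟩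
      rwa [Finset.insert_erase h3]
    · rintro ⟨τ, y⟩ h
      simp only [doors, up, Finset.coe_sigma, Set.mem_sigma_iff, Finset.mem_coe,
        Finset.mem_filter, Finset.mem_univ, true_and] at h ⊢
      rw [Finset.erase_insert h.2.1]
    · rintro ⟨σ, x⟩ h
      simp only [rooms, down, Finset.coe_sigma, Set.mem_sigma_iff, Finset.mem_coe,
        Finset.mem_filter, Finset.mem_univ, true_and] at h ⊢
      rw [Finset.insert_erase h.2.1]
  rw [Finset.card_sigma, Finset.card_sigma] at hcount
  have heven : 2 ∣ ∑ σ ∈ rooms, (down σ).card := Finset.dvd_sum fun σ hσ => by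
    rw [Finset.mem_filter] at hσ
    exact even_card_facets hσ.2.1 (hcon σ hσ.2.2)
  have hτ₀ : (Finset.univ.erase i₀).image e ∈ doors := by
    rw [Finset.mem_filter]
    refine ⟨Finset.mem_univ _, ?_, ?_⟩
    · rw [Finset.card_image_of_injective _ heinj, Finset.card_erase_add_one (Finset.mem_univ _),
        Finset.card_univ]
    · rw [Finset.image_image]
      rw [show c ∘ e = id from funext hc, Finset.image_id]
  rw [← Finset.add_sum_erase _ _ hτ₀] at hcount
  have hone : (up ((Finset.univ.erase i₀).image e)).card = 1 :=
    card_completions_slack hslack hle hf hc rfl ht₀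
  have hrest : 2 ∣ ∑ τ ∈ doors.erase ((Finset.univ.erase i₀).image e), (up τ).card :=
    Finset.dvd_sum fun τ hτ => by
      obtain ⟨h1, h2⟩ := Finset.mem_erase.1 hτ
      rw [Finset.mem_filter] at h2
      exact even_card_completions hslack hle hf hc h2.2.2 h2.2.1 h1
  omega

end Scarf

/-! ### A covering theorem for the simplex -/

/-- The discrete covering theorem: for every colouring of the points of a grid on the dilated
simplex, some grid point `x` has near to it points of all colours `i` for which `x i` is not
small. -/
theorem exists_near_all_colors {I : Type*} [Fintype I] [Nontrivial I] (K : ℕ)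
    (c : (I → ℕ) → I) :
    ∃ x : I → ℕ, ∑ i, x i = K ∧ ∀ i, x i ≤ Fintype.card I ∨ ∃ x' : I → ℕ, ∑ i, x' i = K ∧
      c x' = i ∧ ∀ j, x j ≤ x' j + Fintype.card I ∧ x' j ≤ x j + Fintype.card I := by
  classical
  let T := {x : I → ℕ // x ∈ Finset.piAntidiag Finset.univ K} ⊕ I
  have hT : ∀ x : I → ℕ, x ∈ Finset.piAntidiag Finset.univ K ↔ ∑ i, x i = K := by
    intro x
    simp [Finset.mem_piAntidiag]
  -- The coordinates, shifted by one to make room for the slack points.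
  let k : I → T → ℕ := fun i => Sum.elim (fun x => x.1 i + 1) (fun j => if j = i then 0 else K + 2)
  let N := Fintype.card T
  let r : T → Fin N := Fintype.equivFin T
  -- The rank `r` breaks the ties between points with the same coordinate.
  let f : I → T → ℕ := fun i t => k i t * N + r t
  let e : I → T := Sum.inr
  let d : T → I := Sum.elim (fun x => c x.1) id
  have hlt : ∀ i t t', k i t < k i t' → f i t < f i t' := by
    intro i t t' h
    have h1 : (r t : ℕ) < N := (r t).2
    have h2 : (k i t + 1) * N ≤ k i t' * N := Nat.mul_le_mul_right N h
    simp only [f]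
    rw [add_mul] at h2
    omega
  have hle : ∀ i t t', f i t ≤ f i t' → k i t ≤ k i t' := by
    intro i t t' h
    by_contra hcon
    exact absurd (hlt i t' t (not_le.1 hcon)) (not_lt.2 h)
  have hinj : ∀ i, Function.Injective (f i) := by
    intro i t t' h
    have h1 := le_antisymm (hle i t t' h.le) (hle i t' t h.ge)
    simp only [f, h1] at h
    exact (Fintype.equivFin T).injective (Fin.ext (Nat.add_left_cancel h))
  have hslack : ∀ i j t, t ∉ Set.range e → j ≠ i → f j t < f j (e i) := by
    rintro i j (⟨x, hx⟩ | q) ht hji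
    · apply hlt
      have : x j ≤ K := by
        rw [← (hT x).1 hx]
        exact Finset.single_le_sum (fun _ _ => Nat.zero_le _) (Finset.mem_univ j)
      simp only [k, e, Sum.elim_inl, Sum.elim_inr, if_neg hji.symm]
      omega
    · exact absurd ⟨q, rfl⟩ ht
  have hmin : ∀ i t, f i (e i) ≤ f i t := by
    rintro i (x | q)
    · exact (hlt _ _ _ (by simp [k, e])).le
    · rcases eq_or_ne q i with rfl | hne
      · exact le_rfl
      · exact (hlt _ _ _ (by simp [k, e, hne])).le
  obtain ⟨i₀⟩ : Nonempty I := inferInstance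
  have hx₀ : (Pi.single i₀ K : I → ℕ) ∈ Finset.piAntidiag Finset.univ K := by
    rw [hT]
    simp
  obtain ⟨σ, hdom, hσ⟩ := exists_isDominating_image_eq_univ (c := d) hslack hmin hinj
    (fun _ => rfl) (t₀ := Sum.inl ⟨_, hx₀⟩) (by simp [e])
  have hσne : σ.Nonempty := by
    have : (σ.image d).Nonempty := by
      rw [hσ]
      exact Finset.univ_nonempty
    exact Finset.image_nonempty.1 this
  choose a ha hamin using fun i => Finset.exists_min_image σ (f i) hσne
  let m : I → ℕ := fun i => k i (a i)
  have hm : ∀ i, ∀ x ∈ σ, m i ≤ k i x := fun i x hx => hle _ _ _ (hamin i x hx)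
  -- Otherwise some grid point would have all its unshifted coordinates at least `m i`, against
  -- domination.
  have hsum : K + 1 ≤ ∑ i, m i := by
    by_contra hcon
    have hle' : ∑ i, m i ≤ K := by omega
    let t : I → ℕ := m + Pi.single i₀ (K - ∑ i, m i)
    have ht : t ∈ Finset.piAntidiag Finset.univ K := by
      rw [hT]
      simp only [t, Pi.add_apply, Finset.sum_add_distrib, Finset.sum_pi_single',
        Finset.mem_univ, if_true]
      omega
    obtain ⟨i, hi⟩ := hdom (Sum.inl ⟨t, ht⟩)
    have h1 := hle _ _ _ (hi _ (ha i))
    have h2 : m i ≤ t i := by simp [t]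
    have h3 : t i + 1 ≤ m i := h1
    omega
  have hcol : ∀ i, (Sum.inr i ∈ σ) ∨ ∃ x, Sum.inl x ∈ σ ∧ c x.1 = i := by
    intro i
    have : i ∈ σ.image d := hσ ▸ Finset.mem_univ i
    obtain ⟨x | q, hx, hxi⟩ := Finset.mem_image.1 this
    · exact Or.inr ⟨x, hx, hxi⟩
    · refine Or.inl ?_
      have : q = i := hxi
      rwa [← this]
  have hslackm : ∀ i, (Sum.inr i ∈ σ) → m i = 0 := by
    intro i hi
    have := hm i _ hi
    simpa [k] using this
  obtain ⟨x, hx⟩ : ∃ x, Sum.inl x ∈ σ := by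
    by_contra hcon
    push Not at hcon
    have : ∑ i, m i = 0 := Finset.sum_eq_zero fun i _ =>
      hslackm i ((hcol i).resolve_right fun ⟨x, hx, _⟩ => hcon x hx)
    omega
  -- The shifted coordinates of a grid point of `σ` sum to `K + card I` and are bounded below by the
  -- `m i`, whose sum exceeds `K`; so each of them is close to its lower bound.
  have hbound : ∀ x, Sum.inl x ∈ σ → ∀ j, m j ≤ x.1 j + 1 ∧ x.1 j + 1 ≤ m j + Fintype.card I := by
    intro x hx j
    have h1 : ∀ j, m j ≤ x.1 j + 1 := fun j => hm j _ hx
    refine ⟨h1 j, ?_⟩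
    have h2 : ∑ i, (x.1 i + 1) = K + Fintype.card I := by
      rw [Finset.sum_add_distrib, (hT x.1).1 x.2]
      simp
    rw [← Finset.add_sum_erase _ _ (Finset.mem_univ j)] at h2 hsum
    have h3 := Finset.sum_le_sum fun i (_ : i ∈ Finset.univ.erase j) => h1 i
    omega
  refine ⟨x.1, (hT x.1).1 x.2, fun i => ?_⟩
  rcases hcol i with hi | ⟨x', hx', hc⟩
  · have := (hbound x hx i).2
    rw [hslackm i hi] at this
    exact Or.inl (by omega)
  · refine Or.inr ⟨x'.1, (hT x'.1).1 x'.2, hc, fun j => ?_⟩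
    have h1 := hbound x hx j
    have h2 := hbound x' hx' j
    omega

/-- A covering theorem of Knaster–Kuratowski–Mazurkiewicz type: if closed sets `F i` cover the
simplex, then some point lies in `F i` for all `i` in its support. -/
theorem exists_mem_of_closed_cover_stdSimplex {I : Type*} [Fintype I] [Nontrivial I]
    (F : I → Set (I → ℝ)) (hF : ∀ i, IsClosed (F i))
    (hcov : ∀ x ∈ stdSimplex ℝ I, ∃ i, x ∈ F i) :
    ∃ x ∈ stdSimplex ℝ I, ∀ i, x i = 0 ∨ x ∈ F i := by
  classical
  let s : ℕ → (I → ℕ) → I → ℝ := fun K x i => (x i : ℝ) / (K + 1 : ℕ)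
  have hpos : ∀ K : ℕ, (0 : ℝ) < (K + 1 : ℕ) := fun K => by positivity
  have hs : ∀ (K : ℕ) (x : I → ℕ), ∑ i, x i = K + 1 → s K x ∈ stdSimplex ℝ I := by
    intro K x hx
    refine ⟨fun i => by positivity, ?_⟩
    rw [← Finset.sum_div, ← Nat.cast_sum, hx, div_self (hpos K).ne']
  obtain ⟨i₀⟩ : Nonempty I := inferInstance
  have hcol : ∀ (K : ℕ) (x : I → ℕ), ∃ i, s K x ∈ stdSimplex ℝ I → s K x ∈ F i := by
    intro K x
    by_cases h : s K x ∈ stdSimplex ℝ I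
    · exact (hcov _ h).imp fun i hi _ => hi
    · exact ⟨i₀, fun h' => absurd h' h⟩
  choose c hc using hcol
  choose x hx hnear using fun K : ℕ => exists_near_all_colors (K + 1) (c K)
  obtain ⟨z, hz, φ, hφ, hlim⟩ := (isCompact_stdSimplex ℝ I).tendsto_subseq
    (x := fun K => s K (x K)) fun K => hs K _ (hx K)
  refine ⟨z, hz, fun i => or_iff_not_imp_left.2 fun hzi => ?_⟩
  have hzpos : 0 < z i := lt_of_le_of_ne (hz.1 i) (Ne.symm hzi)
  have hsmall : Tendsto (fun k => (Fintype.card I : ℝ) / (φ k + 1 : ℕ)) atTop (𝓝 0) := by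
    have h1 : Tendsto (fun n : ℕ => (Fintype.card I : ℝ) / (n : ℝ)) atTop (𝓝 0) :=
      tendsto_const_div_atTop_nhds_zero_nat _
    exact h1.comp ((tendsto_add_atTop_nat 1).comp hφ.tendsto_atTop)
  rw [← (hF i).closure_eq, Metric.mem_closure_iff]
  intro ε hε
  have h1 : ∀ᶠ k in atTop, z i / 2 < s (φ k) (x (φ k)) i :=
    ((tendsto_pi_nhds.1 hlim i).eventually (lt_mem_nhds (half_lt_self hzpos)))
  have h2 : ∀ᶠ k in atTop, (Fintype.card I : ℝ) / (φ k + 1 : ℕ) < min (z i / 2) (ε / 2) :=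
    hsmall.eventually (gt_mem_nhds (by positivity))
  have h3 : ∀ᶠ k in atTop, dist (s (φ k) (x (φ k))) z < ε / 2 :=
    (Metric.tendsto_nhds.1 hlim) (ε / 2) (by positivity)
  obtain ⟨k, hk1, hk2, hk3⟩ := (h1.and (h2.and h3)).exists
  rcases hnear (φ k) i with hcon | ⟨x', hx', hci, hd⟩
  · have : s (φ k) (x (φ k)) i ≤ (Fintype.card I : ℝ) / (φ k + 1 : ℕ) :=
      div_le_div_of_nonneg_right (by exact_mod_cast hcon) (hpos _).le
    have := min_le_left (z i / 2) (ε / 2)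
    linarith
  · refine ⟨s (φ k) x', ?_, ?_⟩
    · have := hc (φ k) x' (hs _ _ hx')
      rwa [hci] at this
    · have h4 : dist (s (φ k) (x (φ k))) (s (φ k) x') ≤ (Fintype.card I : ℝ) / (φ k + 1 : ℕ) := by
        rw [dist_pi_le_iff (by positivity)]
        intro j
        obtain ⟨ha, hb⟩ := hd j
        have ha' : (x (φ k) j : ℝ) ≤ x' j + Fintype.card I := by exact_mod_cast ha
        have hb' : (x' j : ℝ) ≤ x (φ k) j + Fintype.card I := by exact_mod_cast hb
        rw [Real.dist_eq, ← sub_div, abs_div, abs_of_pos (hpos (φ k))]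
        exact div_le_div_of_nonneg_right (abs_le.2 ⟨by linarith, by linarith⟩) (hpos _).le
      have h5 := dist_triangle_left z (s (φ k) x') (s (φ k) (x (φ k)))
      have := min_le_right (z i / 2) (ε / 2)
      linarith

/-! ### Symmetric equilibria and Nash equilibria -/

/-- Symmetric equilibria of the symmetric game with payoff matrix `M`: mixed strategies all of
whose used pure strategies are best responses to themselves. -/
def IsSymmetricEquilibrium {I : Type*} [Fintype I] (M : Matrix I I ℝ) (z : I → ℝ) : Prop :=
  z ∈ stdSimplex ℝ I ∧ ∀ i, z i = 0 ∨ ∀ k, (M *ᵥ z) k ≤ (M *ᵥ z) i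

theorem exists_isSymmetricEquilibrium {I : Type*} [Fintype I] [Nontrivial I]
    (M : Matrix I I ℝ) : ∃ z, IsSymmetricEquilibrium M z := by
  obtain ⟨z, hz, h⟩ := exists_mem_of_closed_cover_stdSimplex
    (fun i => {z : I → ℝ | ∀ k, (M *ᵥ z) k ≤ (M *ᵥ z) i})
    (fun i => by
      simp only [Set.ofPred_forall]
      exact isClosed_iInter fun k => isClosed_le (by fun_prop) (by fun_prop))
    (fun z _ => (Finite.exists_max (M *ᵥ z)))
  exact ⟨z, hz, h⟩

theorem dotProduct_le_of_support_subset_argmax {I : Type*} [Fintype I] {x u : I → ℝ}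
    (hx : x ∈ stdSimplex ℝ I) (h : ∀ i, x i = 0 ∨ ∀ k, u k ≤ u i) {x' : I → ℝ}
    (hx' : x' ∈ stdSimplex ℝ I) : x' ⬝ᵥ u ≤ x ⬝ᵥ u := by
  obtain ⟨i, -, hi⟩ : ∃ i ∈ Finset.univ, x i ≠ 0 := Finset.exists_ne_zero_of_sum_ne_zero (by
    rw [hx.2]; exact one_ne_zero)
  have hmax := (h i).resolve_left hi
  have h1 : x ⬝ᵥ u = u i := by
    have : ∀ k ∈ Finset.univ, x k * u k = x k * u i := by
      intro k _
      rcases h k with h0 | h0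
      · simp [h0]
      · rw [le_antisymm (hmax k) (h0 i)]
    rw [dotProduct, Finset.sum_congr rfl this, ← Finset.sum_mul, hx.2, one_mul]
  rw [h1, dotProduct]
  calc ∑ k, x' k * u k ≤ ∑ k, x' k * u i :=
        Finset.sum_le_sum fun k _ => mul_le_mul_of_nonneg_left (hmax k) (hx'.1 k)
    _ = u i := by rw [← Finset.sum_mul, hx'.2, one_mul]

/-- A number that makes all payoffs of both players positive when it is added to them. -/
def payoffShift {n m : ℕ} (A B : Matrix (Fin n) (Fin m) ℝ) : ℝ :=
  1 + ∑ i, ∑ j, (|A i j| + |B i j|)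

theorem payoffShift_pos {n m : ℕ} (A B : Matrix (Fin n) (Fin m) ℝ) (i : Fin n) (j : Fin m) :
    0 < A i j + payoffShift A B ∧ 0 < B i j + payoffShift A B := by
  have h1 : |A i j| + |B i j| ≤ ∑ i, ∑ j, (|A i j| + |B i j|) :=
    (Finset.single_le_sum (f := fun j => |A i j| + |B i j|) (fun _ _ => by positivity)
      (Finset.mem_univ j)).trans
    (Finset.single_le_sum (f := fun i => ∑ j, (|A i j| + |B i j|)) (fun _ _ => by positivity)
      (Finset.mem_univ i))
  have h2 := neg_abs_le (A i j)
  have h3 := neg_abs_le (B i j)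
  have h4 := abs_nonneg (A i j)
  have h5 := abs_nonneg (B i j)
  unfold payoffShift
  constructor <;> linarith

/-- The symmetric game in which a player plays both roles of the bi-matrix game `(A, B)`, made
positive by a shift. -/
def symmetrization {n m : ℕ} (A B : Matrix (Fin n) (Fin m) ℝ) :
    Matrix (Fin n ⊕ Fin m) (Fin n ⊕ Fin m) ℝ :=
  fromBlocks 0 (of fun i j => A i j + payoffShift A B) (of fun j i => B i j + payoffShift A B) 0

theorem symmetrization_mulVec_inl {n m : ℕ} (A B : Matrix (Fin n) (Fin m) ℝ)
    (z : Fin n ⊕ Fin m → ℝ) (i : Fin n) : (symmetrization A B *ᵥ z) (Sum.inl i) =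
      ∑ j, (A i j + payoffShift A B) * z (Sum.inr j) := by
  simp [symmetrization, mulVec, dotProduct]

theorem symmetrization_mulVec_inr {n m : ℕ} (A B : Matrix (Fin n) (Fin m) ℝ)
    (z : Fin n ⊕ Fin m → ℝ) (j : Fin m) : (symmetrization A B *ᵥ z) (Sum.inr j) =
      ∑ i, (B i j + payoffShift A B) * z (Sum.inl i) := by
  simp [symmetrization, mulVec, dotProduct]

/-- If all mass of a symmetric equilibrium were on one role, the pure strategies of that role would
have payoff zero and those of the other one positive payoff. -/
theorem IsSymmetricEquilibrium.sum_inl_pos {n m : ℕ} (hn : 0 < n)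
    {A B : Matrix (Fin n) (Fin m) ℝ} {z : Fin n ⊕ Fin m → ℝ}
    (h : IsSymmetricEquilibrium (symmetrization A B) z) : 0 < ∑ i, z (Sum.inl i) := by
  refine lt_of_le_of_ne (Finset.sum_nonneg fun i _ => h.1.1 _) fun h0 => ?_
  have hz := (Finset.sum_eq_zero_iff_of_nonneg fun i _ => h.1.1 (Sum.inl i)).1 h0.symm
  have h1 := h.1.2
  rw [Fintype.sum_sum_type, ← h0, zero_add] at h1
  obtain ⟨j, -, hj⟩ : ∃ j ∈ Finset.univ, z (Sum.inr j) ≠ 0 :=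
    Finset.exists_ne_zero_of_sum_ne_zero (by rw [h1]; exact one_ne_zero)
  have h2 := (h.2 (Sum.inr j)).resolve_left hj (Sum.inl ⟨0, hn⟩)
  rw [symmetrization_mulVec_inl, symmetrization_mulVec_inr] at h2
  have h3 : ∑ i, (B i j + payoffShift A B) * z (Sum.inl i) = 0 :=
    Finset.sum_eq_zero fun i hi => by rw [hz i hi, mul_zero]
  have h4 : 0 < ∑ j, (A ⟨0, hn⟩ j + payoffShift A B) * z (Sum.inr j) :=
    Finset.sum_pos' (fun j _ => mul_nonneg (payoffShift_pos A B _ j).1.le (h.1.1 _))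
      ⟨j, Finset.mem_univ j, mul_pos (payoffShift_pos A B _ j).1
        (lt_of_le_of_ne (h.1.1 _) (Ne.symm hj))⟩
  linarith

theorem IsSymmetricEquilibrium.sum_inr_pos {n m : ℕ} (hm : 0 < m)
    {A B : Matrix (Fin n) (Fin m) ℝ} {z : Fin n ⊕ Fin m → ℝ}
    (h : IsSymmetricEquilibrium (symmetrization A B) z) : 0 < ∑ j, z (Sum.inr j) := by
  refine lt_of_le_of_ne (Finset.sum_nonneg fun i _ => h.1.1 _) fun h0 => ?_
  have hz := (Finset.sum_eq_zero_iff_of_nonneg fun i _ => h.1.1 (Sum.inr i)).1 h0.symm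
  have h1 := h.1.2
  rw [Fintype.sum_sum_type, ← h0, add_zero] at h1
  obtain ⟨i, -, hi⟩ : ∃ i ∈ Finset.univ, z (Sum.inl i) ≠ 0 :=
    Finset.exists_ne_zero_of_sum_ne_zero (by rw [h1]; exact one_ne_zero)
  have h2 := (h.2 (Sum.inl i)).resolve_left hi (Sum.inr ⟨0, hm⟩)
  rw [symmetrization_mulVec_inl, symmetrization_mulVec_inr] at h2
  have h3 : ∑ j, (A i j + payoffShift A B) * z (Sum.inr j) = 0 :=
    Finset.sum_eq_zero fun j hj => by rw [hz j hj, mul_zero]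
  have h4 : 0 < ∑ i, (B i ⟨0, hm⟩ + payoffShift A B) * z (Sum.inl i) :=
    Finset.sum_pos' (fun i _ => mul_nonneg (payoffShift_pos A B i _).2.le (h.1.1 _))
      ⟨i, Finset.mem_univ i, mul_pos (payoffShift_pos A B i _).2
        (lt_of_le_of_ne (h.1.1 _) (Ne.symm hi))⟩
  linarith

/-- The two halves of a symmetric equilibrium, normalized, are a Nash equilibrium. -/
theorem IsSymmetricEquilibrium.isNashEquilibrium {n m : ℕ} (hn : 0 < n) (hm : 0 < m)
    {A B : Matrix (Fin n) (Fin m) ℝ} {z : Fin n ⊕ Fin m → ℝ}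
    (h : IsSymmetricEquilibrium (symmetrization A B) z) :
    IsNashEquilibrium A B (fun i => z (Sum.inl i) / ∑ i, z (Sum.inl i))
      (fun j => z (Sum.inr j) / ∑ j, z (Sum.inr j)) := by
  have ha := h.sum_inl_pos hn
  have hb := h.sum_inr_pos hm
  set a := ∑ i, z (Sum.inl i) with hadef
  set b := ∑ j, z (Sum.inr j) with hbdef
  set x : Fin n → ℝ := fun i => z (Sum.inl i) / a with hx
  set y : Fin m → ℝ := fun j => z (Sum.inr j) / b with hy
  have hxs : x ∈ stdSimplex ℝ (Fin n) :=
    ⟨fun i => div_nonneg (h.1.1 _) ha.le, by rw [hx, ← Finset.sum_div, div_self ha.ne']⟩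
  have hys : y ∈ stdSimplex ℝ (Fin m) :=
    ⟨fun i => div_nonneg (h.1.1 _) hb.le, by rw [hy, ← Finset.sum_div, div_self hb.ne']⟩
  have h1 : ∀ i, (symmetrization A B *ᵥ z) (Sum.inl i) =
      b * ((A *ᵥ y) i + payoffShift A B) := by
    intro i
    rw [symmetrization_mulVec_inl, mulVec, dotProduct, mul_add, Finset.mul_sum]
    simp only [add_mul, Finset.sum_add_distrib]
    rw [← Finset.mul_sum, ← hbdef, mul_comm (payoffShift A B)]
    congr 1
    refine Finset.sum_congr rfl fun j _ => ?_
    rw [hy]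
    field_simp
  have h2 : ∀ j, (symmetrization A B *ᵥ z) (Sum.inr j) =
      a * ((x ᵥ* B) j + payoffShift A B) := by
    intro j
    rw [symmetrization_mulVec_inr, vecMul, dotProduct, mul_add, Finset.mul_sum]
    simp only [add_mul, Finset.sum_add_distrib]
    rw [← Finset.mul_sum, ← hadef, mul_comm (payoffShift A B)]
    congr 1
    refine Finset.sum_congr rfl fun i _ => ?_
    rw [hx]
    field_simp
  refine ⟨hxs, hys, fun x' hx' => ?_, fun y' hy' => ?_⟩
  · refine dotProduct_le_of_support_subset_argmax hxs (fun i => ?_) hx'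
    refine (h.2 (Sum.inl i)).imp (fun h0 => by rw [hx]; simp [h0]) fun h0 k => ?_
    have := h0 (Sum.inl k)
    rw [h1, h1] at this
    have := le_of_mul_le_mul_left this hb
    linarith
  · rw [dotProduct_mulVec, dotProduct_mulVec, dotProduct_comm _ y', dotProduct_comm _ y]
    refine dotProduct_le_of_support_subset_argmax hys (fun j => ?_) hy'
    refine (h.2 (Sum.inr j)).imp (fun h0 => by rw [hy]; simp [h0]) fun h0 k => ?_
    have := h0 (Sum.inr k)
    rw [h2, h2] at this
    have := le_of_mul_le_mul_left this ha
    linarith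

theorem nontrivial_fin_sum {n m : ℕ} (hn : 0 < n) (hm : 0 < m) : Nontrivial (Fin n ⊕ Fin m) :=
  ⟨Sum.inl ⟨0, hn⟩, Sum.inr ⟨0, hm⟩, by simp⟩

/-- **Nash's theorem** for bi-matrix games. -/
theorem exists_isNashEquilibrium {n m : ℕ} (hn : 0 < n) (hm : 0 < m)
    (A B : Matrix (Fin n) (Fin m) ℝ) : ∃ x y, IsNashEquilibrium A B x y := by
  have := nontrivial_fin_sum hn hm
  obtain ⟨z, hz⟩ := exists_isSymmetricEquilibrium (symmetrization A B)
  exact ⟨_, _, hz.isNashEquilibrium hn hm⟩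

/-! ### Extreme symmetric equilibria -/

section ExtremeEquilibria

variable {I : Type*} [Fintype I] {M : Matrix I I ℝ} {z z' : I → ℝ}

open Classical in
/-- The pure strategies that `z` does not use. -/
noncomputable def zeroSet (z : I → ℝ) : Finset I := Finset.univ.filter fun i => z i = 0

open Classical in
/-- The pure best responses to `z`. -/
noncomputable def bestResponses (M : Matrix I I ℝ) (z : I → ℝ) : Finset I :=
  Finset.univ.filter fun i => ∀ k, (M *ᵥ z) k ≤ (M *ᵥ z) i

theorem mem_zeroSet {i : I} : i ∈ zeroSet z ↔ z i = 0 := by simp [zeroSet]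

theorem mem_bestResponses {i : I} :
    i ∈ bestResponses M z ↔ ∀ k, (M *ᵥ z) k ≤ (M *ᵥ z) i := by simp [bestResponses]

/-- The extreme symmetric equilibria: those at which the number of tight inequalities among
`0 ≤ z i` and `(M *ᵥ z) i ≤ max (M *ᵥ z)` is as large as possible. -/
def IsExtremeEquilibrium (M : Matrix I I ℝ) (z : I → ℝ) : Prop :=
  IsSymmetricEquilibrium M z ∧ ∀ z', IsSymmetricEquilibrium M z' →
    (zeroSet z').card + (bestResponses M z').card ≤ (zeroSet z).card + (bestResponses M z).card

theorem exists_isExtremeEquilibrium [Nontrivial I] (M : Matrix I I ℝ) :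
    ∃ z, IsExtremeEquilibrium M z := by
  let s : Set ℕ := (fun z => (zeroSet z).card + (bestResponses M z).card) ''
    {z | IsSymmetricEquilibrium M z}
  have hne : s.Nonempty := let ⟨z, hz⟩ := exists_isSymmetricEquilibrium M; ⟨_, z, hz, rfl⟩
  have hbdd : BddAbove s := ⟨Fintype.card I + Fintype.card I, by
    rintro _ ⟨z, -, rfl⟩
    exact add_le_add (Finset.card_le_univ _) (Finset.card_le_univ _)⟩
  obtain ⟨z, hz, hzs⟩ := Nat.sSup_mem hne hbdd
  exact ⟨z, hz, fun z' hz' => (le_csSup hbdd ⟨z', hz', rfl⟩).trans_eq hzs.symm⟩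

theorem IsExtremeEquilibrium.sets_eq (h : IsExtremeEquilibrium M z) (hz' : z' ∈ stdSimplex ℝ I)
    (h0 : zeroSet z ⊆ zeroSet z') (hb : bestResponses M z ⊆ bestResponses M z') :
    zeroSet z' = zeroSet z ∧ bestResponses M z' = bestResponses M z := by
  have hsym : IsSymmetricEquilibrium M z' := ⟨hz', fun i => (h.1.2 i).imp
    (fun hi => mem_zeroSet.1 (h0 (mem_zeroSet.2 hi)))
    (fun hi => mem_bestResponses.1 (hb (mem_bestResponses.2 hi)))⟩
  have h1 := h.2 z' hsym
  have h2 := Finset.card_le_card h0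
  have h3 := Finset.card_le_card hb
  exact ⟨(Finset.eq_of_subset_of_card_le h0 (by omega)).symm,
    (Finset.eq_of_subset_of_card_le hb (by omega)).symm⟩

/-- An extreme equilibrium is determined by its tight inequalities: on the line through two points
satisfying them, the points that satisfy all inequalities would form a nonempty closed set that is
open by extremality, so the whole line would lie in the simplex. -/
theorem IsExtremeEquilibrium.eq_of_subset (h : IsExtremeEquilibrium M z)
    (hz' : z' ∈ stdSimplex ℝ I) (h0 : zeroSet z ⊆ zeroSet z')
    (hb : bestResponses M z ⊆ bestResponses M z') : z' = z := by
  by_contra hne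
  let w : ℝ → I → ℝ := fun t => z + t • (z' - z)
  have hMw : ∀ t k, (M *ᵥ w t) k = (M *ᵥ z) k + t * ((M *ᵥ z') k - (M *ᵥ z) k) := by
    intro t k
    simp [w, mulVec_add, mulVec_smul, mulVec_sub]
  have hw0 : ∀ t, zeroSet z ⊆ zeroSet (w t) := by
    intro t i hi
    have h1 := mem_zeroSet.1 (h0 hi)
    rw [mem_zeroSet] at hi ⊢
    simp [w, hi, h1]
  have hwsum : ∀ t, ∑ i, w t i = 1 := by
    intro t
    simp only [w, Pi.add_apply, Pi.smul_apply, Pi.sub_apply, smul_eq_mul, Finset.sum_add_distrib,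
      ← Finset.mul_sum, Finset.sum_sub_distrib, h.1.1.2, hz'.2]
    ring
  have hwb : ∀ t, ∀ i ∈ bestResponses M z, ∀ k ∈ bestResponses M z,
      (M *ᵥ w t) k = (M *ᵥ w t) i := by
    intro t i hi k hk
    have h1 := le_antisymm (mem_bestResponses.1 hi k) (mem_bestResponses.1 hk i)
    have h2 := le_antisymm (mem_bestResponses.1 (hb hi) k) (mem_bestResponses.1 (hb hk) i)
    rw [hMw, hMw, h1, h2]
  have hwc : Continuous w := by fun_prop
  let S : Set ℝ := {t | w t ∈ stdSimplex ℝ I ∧ bestResponses M z ⊆ bestResponses M (w t)}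
  have hclosed : IsClosed S := by
    have : S = w ⁻¹' stdSimplex ℝ I ∩
        ⋂ i ∈ bestResponses M z, ⋂ k, {t | (M *ᵥ w t) k ≤ (M *ᵥ w t) i} := by
      ext t
      simp only [S, Set.mem_ofPred_eq, Set.mem_inter_iff, Set.mem_preimage, Set.mem_iInter,
        Finset.subset_iff, mem_bestResponses]
    rw [this]
    refine ((isClosed_stdSimplex ℝ I).preimage hwc).inter ?_
    refine isClosed_biInter fun i _ => isClosed_iInter fun k => ?_
    exact isClosed_le (by fun_prop) (by fun_prop)
  have hopen : IsOpen S := by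
    rw [isOpen_iff_mem_nhds]
    rintro t ⟨ht, htb⟩
    obtain ⟨e0, eb⟩ := h.sets_eq ht (hw0 t) htb
    have hev1 : ∀ᶠ s in 𝓝 t, ∀ i, i ∉ zeroSet z → 0 < w s i := by
      refine eventually_all.2 fun i => eventually_imp_distrib_left.2 fun hi => ?_
      rw [← e0, mem_zeroSet] at hi
      have hc : Continuous fun s => w s i := by fun_prop
      exact hc.continuousAt.eventually (lt_mem_nhds (lt_of_le_of_ne (ht.1 i) (Ne.symm hi)))
    have hev2 : ∀ᶠ s in 𝓝 t, ∀ i k, i ∈ bestResponses M z → k ∉ bestResponses M z →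
        (M *ᵥ w s) k < (M *ᵥ w s) i := by
      refine eventually_all.2 fun i => eventually_all.2 fun k =>
        eventually_imp_distrib_left.2 fun hi => eventually_imp_distrib_left.2 fun hk => ?_
      have hlt : (M *ᵥ w t) k < (M *ᵥ w t) i := by
        by_contra hcon
        apply hk
        rw [← eb, mem_bestResponses]
        exact fun l => (mem_bestResponses.1 (htb hi) l).trans (not_lt.1 hcon)
      have hc1 : Continuous fun s => (M *ᵥ w s) k := by fun_prop
      have hc2 : Continuous fun s => (M *ᵥ w s) i := by fun_prop
      exact hc1.continuousAt.eventually_lt hc2.continuousAt hlt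
    filter_upwards [hev1, hev2] with s h1 h2
    refine ⟨⟨fun i => ?_, hwsum s⟩, fun i hi => mem_bestResponses.2 fun k => ?_⟩
    · by_cases hi : i ∈ zeroSet z
      · exact (mem_zeroSet.1 (hw0 s hi)).ge
      · exact (h1 i hi).le
    · by_cases hk : k ∈ bestResponses M z
      · exact (hwb s i hi k hk).le
      · exact (h2 i k hi hk).le
  have huniv : S = Set.univ := IsClopen.eq_univ ⟨hclosed, hopen⟩
    ⟨0, by simpa [S, w] using h.1.1⟩
  obtain ⟨i, hi⟩ := Function.ne_iff.1 hne
  have hi' : z' i - z i ≠ 0 := sub_ne_zero.2 hi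
  have hmem : (2 - z i) / (z' i - z i) ∈ S := huniv ▸ Set.mem_univ _
  have h2 : w ((2 - z i) / (z' i - z i)) i = 2 := by
    simp only [w, Pi.add_apply, Pi.smul_apply, Pi.sub_apply, smul_eq_mul]
    rw [div_mul_cancel₀ _ hi']
    ring
  have h3 := Finset.single_le_sum (fun k _ => hmem.1.1 k) (Finset.mem_univ i)
  rw [h2, hmem.1.2] at h3
  norm_num at h3

end ExtremeEquilibria

/-- A function into a compact set is continuous on `S` if over `S` its graph is the trace of a
closed relation. -/
theorem continuousOn_of_closed_relation {X Y : Type*} [TopologicalSpace X] [TopologicalSpace Y]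
    {K : Set Y} (hK : IsCompact K) {C : Set (X × Y)} (hC : IsClosed C) {S : Set X} {φ : X → Y}
    (hφK : ∀ x ∈ S, φ x ∈ K) (hφC : ∀ x ∈ S, (x, φ x) ∈ C)
    (huniq : ∀ x ∈ S, ∀ y ∈ K, (x, y) ∈ C → y = φ x) : ContinuousOn φ S := by
  intro x hx
  refine hK.tendsto_nhds_of_unique_mapClusterPt
    (eventually_nhdsWithin_of_forall hφK) fun y hy hcl => huniq x hx y hy ?_
  by_contra hcon
  obtain ⟨U, hU, V, hV, hUV⟩ := mem_nhds_prod_iff.1 (hC.isOpen_compl.mem_nhds hcon)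
  have h1 := (mapClusterPt_iff_frequently.1 hcl) V hV
  have h2 : ∀ᶠ x' in 𝓝[S] x, x' ∈ U ∧ x' ∈ S := by
    filter_upwards [mem_nhdsWithin_of_mem_nhds hU, self_mem_nhdsWithin] with a ha haS
    exact ⟨ha, haS⟩
  obtain ⟨x', h3, h4, h5⟩ := (h1.and_eventually h2).exists
  exact hUV (Set.mk_mem_prod h4 h3) (hφC x' h5)

/-- Symmetric equilibria can be chosen piecewise continuously, on finitely many pieces: the pieces
are given by the tight inequalities of a chosen extreme equilibrium. -/
theorem exists_piecewise_continuous_isSymmetricEquilibrium (I : Type*) [Fintype I]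
    [Nontrivial I] : ∃ (E : Finset I × Finset I → Set (Matrix I I ℝ)) (φ : Matrix I I ℝ → I → ℝ),
      (∀ M, ∃ p, M ∈ E p) ∧ (∀ p, ContinuousOn φ (E p)) ∧ ∀ M, IsSymmetricEquilibrium M (φ M) := by
  choose φ hφ using fun M : Matrix I I ℝ => exists_isExtremeEquilibrium M
  refine ⟨fun p => {M | zeroSet (φ M) = p.1 ∧ bestResponses M (φ M) = p.2}, φ,
    fun M => ⟨(_, _), rfl, rfl⟩, fun p => ?_, fun M => (hφ M).1⟩
  let C : Set (Matrix I I ℝ × (I → ℝ)) := (⋂ i ∈ p.1, {q | q.2 i = 0}) ∩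
    ⋂ i ∈ p.2, ⋂ k, {q | (q.1 *ᵥ q.2) k ≤ (q.1 *ᵥ q.2) i}
  have hmem : ∀ q, q ∈ C ↔ p.1 ⊆ zeroSet q.2 ∧ p.2 ⊆ bestResponses q.1 q.2 := by
    intro q
    simp only [C, Set.mem_inter_iff, Set.mem_iInter, Set.mem_ofPred_eq, Finset.subset_iff,
      mem_zeroSet, mem_bestResponses]
  have hC : IsClosed C := by
    refine (isClosed_biInter fun i _ => ?_).inter
      (isClosed_biInter fun i _ => isClosed_iInter fun k => ?_)
    · exact isClosed_eq (by fun_prop) (by fun_prop)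
    · exact isClosed_le (by fun_prop) (by fun_prop)
  refine continuousOn_of_closed_relation (isCompact_stdSimplex ℝ I) hC
    (fun M _ => (hφ M).1.1) (fun M hM => ?_) (fun M hM z hz hzC => ?_)
  · rw [hmem]
    exact ⟨hM.1.ge, hM.2.ge⟩
  · rw [hmem] at hzC
    exact (hφ M).eq_of_subset hz (hM.1.le.trans hzC.1) (hM.2.le.trans hzC.2)

/-! ### Names of real numbers, strategies and games -/

theorem exists_cylinder_subset {α : Type*} [TopologicalSpace α] [DiscreteTopology α]
    {w : ℕ → α} {U : Set (ℕ → α)} (hU : U ∈ 𝓝 w) :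
    ∃ N, cylinder (E := fun _ => α) w N ⊆ U := by
  obtain ⟨_, ⟨x, N, rfl⟩, hw, hsub⟩ :=
    (isTopologicalBasis_cylinders (fun _ : ℕ => α)).mem_nhds_iff.1 hU
  exact ⟨N, (mem_cylinder_iff_eq.1 hw).subset.trans hsub⟩

theorem cylinder_mem_nhds {α : Type*} [TopologicalSpace α] [DiscreteTopology α]
    (w : ℕ → α) (N : ℕ) : cylinder (E := fun _ => α) w N ∈ 𝓝 w :=
  (isOpen_cylinder _ w N).mem_nhds (self_mem_cylinder w N)

theorem exists_cylinder_of_mem_nhdsWithin {α : Type*} [TopologicalSpace α] [DiscreteTopology α]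
    {w : ℕ → α} {S U : Set (ℕ → α)} (hU : U ∈ 𝓝[S] w) :
    ∃ N, ∀ w' ∈ S, w' ∈ cylinder (E := fun _ => α) w N → w' ∈ U := by
  obtain ⟨V, hV, hVU⟩ := mem_nhdsWithin_iff_exists_mem_nhds_inter.1 hU
  obtain ⟨N, hN⟩ := exists_cylinder_subset hV
  exact ⟨N, fun w' hw' hc => hVU ⟨hN hc, hw'⟩⟩

/-- A continuous real function on a set of sequences is uniformly approximated by continuous
functions with rational values: the value is chosen on the largest cylinder on which a rational
constant is a good approximation. -/
theorem exists_locallyConstant_approx {α : Type*} [TopologicalSpace α] [DiscreteTopology α]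
    {S : Set (ℕ → α)} {r : (ℕ → α) → ℝ} (hr : ContinuousOn r S) {ε : ℝ} (hε : 0 < ε) :
    ∃ q : (ℕ → α) → ℚ, (∀ w ∈ S, |(q w : ℝ) - r w| ≤ ε) ∧ ∀ w ∈ S, ∀ᶠ w' in 𝓝[S] w, q w' = q w := by
  let P : Set (ℕ → α) → ℚ → Prop := fun C q => ∀ w ∈ S, w ∈ C → |(q : ℝ) - r w| ≤ ε
  let good : (ℕ → α) → Set ℕ := fun w => {N | ∃ q, P (cylinder (E := fun _ => α) w N) q}
  let N : (ℕ → α) → ℕ := fun w => sInf (good w)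
  have hgood : ∀ w ∈ S, (good w).Nonempty := by
    intro w hw
    obtain ⟨q, hq⟩ := exists_rat_near (r w) (half_pos hε)
    have h1 : ∀ᶠ w' in 𝓝[S] w, |r w' - r w| < ε / 2 :=
      (hr w hw).eventually (Metric.ball_mem_nhds (r w) (half_pos hε))
    obtain ⟨k, hk⟩ := exists_cylinder_of_mem_nhdsWithin h1
    refine ⟨k, q, fun w' hw' hc => ?_⟩
    have h2 : |r w' - r w| < ε / 2 := hk w' hw' hc
    rw [abs_lt] at h2 hq
    exact abs_le.2 ⟨by linarith, by linarith⟩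
  have hsub : ∀ w w' k, w' ∈ cylinder (E := fun _ => α) w (N w) → k ≤ N w →
      cylinder (E := fun _ => α) w' k = cylinder (E := fun _ => α) w k :=
    fun w w' k h hk => mem_cylinder_iff_eq.1 (cylinder_anti w hk h)
  have hN : ∀ w ∈ S, ∀ w' ∈ S, w' ∈ cylinder (E := fun _ => α) w (N w) → N w' = N w := by
    intro w hw w' hw' hc
    have h1 : N w ∈ good w' := by
      have := Nat.sInf_mem (hgood w hw)
      simp only [good, Set.mem_ofPred_eq] at this ⊢
      rwa [hsub w w' _ hc le_rfl]
    have h2 : N w' ≤ N w := Nat.sInf_le h1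
    have h3 : N w' ∈ good w := by
      have := Nat.sInf_mem (hgood w' hw')
      simp only [good, Set.mem_ofPred_eq] at this ⊢
      rwa [← hsub w w' _ hc h2]
    exact le_antisymm h2 (Nat.sInf_le h3)
  refine ⟨fun w => Classical.epsilon (P (cylinder (E := fun _ => α) w (N w))),
    fun w hw => ?_, fun w hw => ?_⟩
  · exact Classical.epsilon_spec (Nat.sInf_mem (hgood w hw)) w hw (self_mem_cylinder _ _)
  · filter_upwards [self_mem_nhdsWithin,
      mem_nhdsWithin_of_mem_nhds (cylinder_mem_nhds w (N w))] with w' hw' hc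
    rw [hN w hw w' hw' hc, hsub w w' _ hc le_rfl]

/-- Values of continuous real functions on sets of sequences can be named continuously. -/
theorem exists_continuousOn_isRealName {ν : ℕ → ℚ} (hν : Function.Surjective ν) {α : Type*}
    [TopologicalSpace α] [DiscreteTopology α] {S : Set (ℕ → α)} {r : (ℕ → α) → ℝ}
    (hr : ContinuousOn r S) :
    ∃ c : (ℕ → α) → ℕ → ℕ, ContinuousOn c S ∧ ∀ w ∈ S, IsRealName ν (c w) (r w) := by
  choose q hq hloc using fun i : ℕ =>
    exists_locallyConstant_approx hr (show (0 : ℝ) < 2⁻¹ ^ i by positivity)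
  obtain ⟨μ, hμ⟩ := hν.hasRightInverse
  refine ⟨fun w i => μ (q i w), ?_, fun w hw i => ?_⟩
  · refine continuousOn_pi.2 fun i w hw => ?_
    refine continuousWithinAt_const.congr_of_eventuallyEq (f := fun _ => μ (q i w)) ?_ rfl
    filter_upwards [hloc i w hw] with w' hw'
    rw [hw']
  · rw [hμ]
    exact hq i w hw

theorem IsRealName.unique {ν : ℕ → ℚ} {c : ℕ → ℕ} {x y : ℝ} (hx : IsRealName ν c x)
    (hy : IsRealName ν c y) : x = y := by
  have hlim : ∀ {x : ℝ}, IsRealName ν c x → Tendsto (fun i => (ν (c i) : ℝ)) atTop (𝓝 x) := by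
    intro x hx
    rw [tendsto_iff_dist_tendsto_zero]
    exact squeeze_zero (fun _ => dist_nonneg) hx
      (tendsto_pow_atTop_nhds_zero_of_lt_one (by norm_num) (by norm_num))
  exact tendsto_nhds_unique (hlim hx) (hlim hy)

theorem continuousOn_of_isRealName {ν : ℕ → ℚ} {X : Type*} [TopologicalSpace X] {S : Set X}
    {c : X → ℕ → ℕ} (hc : ContinuousOn c S) {r : X → ℝ}
    (h : ∀ x ∈ S, IsRealName ν (c x) (r x)) : ContinuousOn r S := by
  refine continuousOn_of_uniform_approx_of_continuousOn fun u hu => ?_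
  obtain ⟨ε, hε, hεu⟩ := Metric.mem_uniformity_dist.1 hu
  obtain ⟨i, hi⟩ := exists_pow_lt_of_lt_one hε (show (2 : ℝ)⁻¹ < 1 by norm_num)
  refine ⟨fun x => (ν (c x i) : ℝ), ?_, fun x hx => hεu ?_⟩
  · exact (continuous_of_discreteTopology (f := fun k : ℕ => (ν k : ℝ))).comp_continuousOn
      (continuousOn_pi.1 hc i)
  · rw [dist_comm, Real.dist_eq]
    exact (h x hx i).trans_lt hi

/-- The sequence with components `f 0, …, f (k - 1)`. -/
def interleave (k : ℕ) (f : ℕ → ℕ → ℕ) : ℕ → ℕ := fun t => f (t % k) (t / k)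

theorem component_interleave {k j : ℕ} (hj : j < k) (f : ℕ → ℕ → ℕ) :
    component k j (interleave k f) = f j := by
  funext i
  have hk : 0 < k := by omega
  simp only [component, interleave, Nat.mul_add_mod, Nat.mod_eq_of_lt hj, Nat.mul_add_div hk,
    Nat.div_eq_of_lt hj, add_zero]

theorem continuous_component (k j : ℕ) : Continuous (component k j) :=
  continuous_pi fun _ => continuous_apply _

theorem continuous_withSize (n m : ℕ) : Continuous (withSize n m) := by
  refine continuous_pi fun i => ?_
  unfold withSize
  split_ifs <;> fun_prop

/-- Values of continuous functions into the pairs of strategies can be named continuously. -/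
theorem exists_continuousOn_isStrategyPairName {ν : ℕ → ℚ} (hν : Function.Surjective ν)
    {α : Type*} [TopologicalSpace α] [DiscreteTopology α] {S : Set (ℕ → α)} {n m : ℕ}
    {x : (ℕ → α) → Fin n → ℝ} {y : (ℕ → α) → Fin m → ℝ}
    (hx : ContinuousOn x S) (hy : ContinuousOn y S) :
    ∃ c : (ℕ → α) → ℕ → ℕ, ContinuousOn c S ∧
      ∀ w ∈ S, IsStrategyPairName ν (c w) (x w) (y w) := by
  choose a ha hax using fun i => exists_continuousOn_isRealName hν (continuousOn_pi.1 hx i)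
  choose b hb hby using fun j => exists_continuousOn_isRealName hν (continuousOn_pi.1 hy j)
  let f : (ℕ → α) → ℕ → ℕ → ℕ := fun w i => if h : i < n then a ⟨i, h⟩ w else 0
  let g : (ℕ → α) → ℕ → ℕ → ℕ := fun w j => if h : j < m then b ⟨j, h⟩ w else 0
  have hf : ∀ i, ContinuousOn (fun w => f w i) S := by
    intro i
    by_cases h : i < n
    · simpa only [f, dif_pos h] using ha ⟨i, h⟩
    · simpa only [f, dif_neg h] using continuousOn_const
  have hg : ∀ i, ContinuousOn (fun w => g w i) S := by
    intro i
    by_cases h : i < m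
    · simpa only [g, dif_pos h] using hb ⟨i, h⟩
    · simpa only [g, dif_neg h] using continuousOn_const
  let u : (ℕ → α) → ℕ → ℕ → ℕ := fun w k => if k = 0 then interleave n (f w) else
    interleave m (g w)
  refine ⟨fun w => withSize n m (interleave 2 (u w)), ?_, fun w hw => ⟨_, rfl, ?_, ?_⟩⟩
  · refine (continuous_withSize n m).comp_continuousOn (continuousOn_pi.2 fun t => ?_)
    by_cases h : t % 2 = 0
    · simp only [interleave, u, if_pos h]
      exact continuousOn_pi.1 (hf _) _
    · simp only [interleave, u, if_neg h]
      exact continuousOn_pi.1 (hg _) _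
  · intro i
    have : component n i (component 2 0 (interleave 2 (u w))) = a i w := by
      rw [component_interleave (by norm_num)]
      simp only [u, if_pos]
      rw [component_interleave i.2]
      simp [f]
    rw [this]
    exact hax i w hw
  · intro j
    have : component m j (component 2 1 (interleave 2 (u w))) = b j w := by
      rw [component_interleave (by norm_num)]
      simp only [u, if_neg one_ne_zero]
      rw [component_interleave j.2]
      simp [g]
    rw [this]
    exact hby j w hw

/-- The prefix of length `n + m + 1` determines the size `n × m`. -/
theorem size_eq_of_withSize {n m n' m' : ℕ} (hm : 0 < m) (hm' : 0 < m')
    {w w' w₂ w₂' : ℕ → ℕ} (hw : w = withSize n m w₂)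
    (hw' : w' = withSize n' m' w₂') (h : ∀ i < n + m + 1, w' i = w i) : n' = n ∧ m' = m := by
  have hn : n' = n := by
    rcases lt_trichotomy n n' with hlt | heq | hlt
    · have := h n (by omega)
      rw [hw, hw'] at this
      simp [withSize, hlt, hm] at this
    · exact heq.symm
    · have := h n' (by omega)
      rw [hw, hw'] at this
      simp [withSize, hlt, hm'] at this
  subst hn
  refine ⟨rfl, ?_⟩
  rcases lt_trichotomy m m' with hlt | heq | hlt
  · have := h (n' + m) (by omega)
    rw [hw, hw'] at this
    simp [withSize, hlt] at this
  · exact heq.symm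
  · have := h (n' + m') (by omega)
    rw [hw, hw'] at this
    simp [withSize, hlt] at this

/-- The names of `n × m` games. -/
def gameNames (ν : ℕ → ℚ) (n m : ℕ) : Set (ℕ → ℕ) :=
  {w | ∃ A B : Matrix (Fin n) (Fin m) ℝ, IsGameName ν w A B}

theorem size_eq_of_gameNames {ν : ℕ → ℚ} {n m n' m' : ℕ} (hm : 0 < m) (hm' : 0 < m')
    {w w' : ℕ → ℕ} (hw : w ∈ gameNames ν n m) (hw' : w' ∈ gameNames ν n' m')
    (h : w' ∈ cylinder w (n + m + 1)) : n' = n ∧ m' = m := by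
  obtain ⟨A, B, w₂, h1, -⟩ := hw
  obtain ⟨A', B', w₂', h1', -⟩ := hw'
  exact size_eq_of_withSize hm hm' h1 h1' fun i hi => h i hi

theorem IsGameName.tail {ν : ℕ → ℚ} {n m : ℕ} {w : ℕ → ℕ} {A B : Matrix (Fin n) (Fin m) ℝ}
    (h : IsGameName ν w A B) (i : Fin n) (j : Fin m) :
    IsRealName ν (component (n * m) (j * n + i) (component 2 0 fun k => w (k + (n + m + 1))))
      (A i j) ∧
    IsRealName ν (component (n * m) (j * n + i) (component 2 1 fun k => w (k + (n + m + 1))))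
      (B i j) := by
  obtain ⟨w₂, rfl, hw⟩ := h
  have : (fun k => withSize n m w₂ (k + (n + m + 1))) = w₂ := by
    funext k
    have h1 : ¬ k + (n + m + 1) < n := by omega
    have h2 : ¬ k + (n + m + 1) < n + m := by omega
    have h3 : ¬ k + (n + m + 1) = n + m := by omega
    simp [withSize, h1, h2, h3]
  rw [this]
  exact hw i j

theorem IsGameName.unique {ν : ℕ → ℚ} {n m : ℕ} {w : ℕ → ℕ} {A B A' B' : Matrix (Fin n) (Fin m) ℝ}
    (h : IsGameName ν w A B) (h' : IsGameName ν w A' B') : A = A' ∧ B = B' :=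
  ⟨Matrix.ext fun i j => (h.tail i j).1.unique (h'.tail i j).1,
    Matrix.ext fun i j => (h.tail i j).2.unique (h'.tail i j).2⟩

/-- A game depends continuously on its name. -/
theorem exists_continuousOn_game (ν : ℕ → ℚ) (n m : ℕ) :
    ∃ A B : (ℕ → ℕ) → Matrix (Fin n) (Fin m) ℝ, ContinuousOn A (gameNames ν n m) ∧
      ContinuousOn B (gameNames ν n m) ∧ ∀ w ∈ gameNames ν n m, IsGameName ν w (A w) (B w) := by
  classical
  have hex : ∀ w, ∃ A B : Matrix (Fin n) (Fin m) ℝ, w ∈ gameNames ν n m → IsGameName ν w A B := by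
    intro w
    by_cases h : w ∈ gameNames ν n m
    · obtain ⟨A, B, hAB⟩ := h
      exact ⟨A, B, fun _ => hAB⟩
    · exact ⟨0, 0, fun h' => absurd h' h⟩
  choose A B hAB using hex
  have hcont : ∀ k l, Continuous fun w : ℕ → ℕ =>
      component (n * m) k (component 2 l fun i => w (i + (n + m + 1))) := fun k l =>
    (continuous_component _ _).comp ((continuous_component _ _).comp
      (continuous_pi fun _ => continuous_apply _))
  refine ⟨A, B, ?_, ?_, hAB⟩
  · exact continuousOn_pi.2 fun i => continuousOn_pi.2 fun j => continuousOn_of_isRealName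
      (hcont _ _).continuousOn fun w hw => ((hAB w hw).tail i j).1
  · exact continuousOn_pi.2 fun i => continuousOn_pi.2 fun j => continuousOn_of_isRealName
      (hcont _ _).continuousOn fun w hw => ((hAB w hw).tail i j).2

/-! ### Choice from compact sets by separation -/

/-- All sequences with (reversed) initial segment `σ` are excluded as solutions by the first `k`
terms of `w`. -/
def Excluded (D : Set (ℕ → ℕ)) (R : (ℕ → ℕ) → (ℕ → Bool) → Prop) (w : ℕ → ℕ) (σ : List Bool)
    (k : ℕ) : Prop :=
  ∀ w' ∈ D, w' ∈ cylinder w k → ∀ c, res c σ.length = σ → ¬ R w' c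

section Choice

variable {D : Set (ℕ → ℕ)} {R : (ℕ → ℕ) → (ℕ → Bool) → Prop} {w : ℕ → ℕ} {σ : List Bool}

theorem Excluded.mono {k l : ℕ} (h : Excluded D R w σ k) (hkl : k ≤ l) : Excluded D R w σ l :=
  fun w' hw' hc => h w' hw' (cylinder_anti w hkl hc)

theorem excluded_congr {w' : ℕ → ℕ} {k : ℕ} (h : w' ∈ cylinder w k) :
    Excluded D R w' σ k ↔ Excluded D R w σ k := by
  rw [Excluded, Excluded, mem_cylinder_iff_eq.1 h]

/-- By compactness of the Cantor space, a string that extends to no solution is excluded by a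
finite part of `w`. -/
theorem exists_excluded
    (hcl : ∀ w ∈ D, ∀ c, ¬ R w c → ∃ N, ∀ w' ∈ D, w' ∈ cylinder w N →
      ∀ c' ∈ cylinder (E := fun _ => Bool) c N, ¬ R w' c')
    (hw : w ∈ D) (hσ : ∀ c, res c σ.length = σ → ¬ R w c) : ∃ k, Excluded D R w σ k := by
  have : ∃ k, ∀ w' ∈ D, w' ∈ cylinder w k → ∀ c ∈ (Set.univ : Set (ℕ → Bool)),
      res c σ.length = σ → ¬ R w' c := by
    refine isCompact_univ.induction_on
      (p := fun S => ∃ k, ∀ w' ∈ D, w' ∈ cylinder w k → ∀ c ∈ S, res c σ.length = σ → ¬ R w' c)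
      ⟨0, by simp⟩ ?_ ?_ ?_
    · rintro S T hST ⟨k, hk⟩
      exact ⟨k, fun w' hw' hc c hcS => hk w' hw' hc c (hST hcS)⟩
    · rintro S T ⟨k, hk⟩ ⟨l, hl⟩
      refine ⟨max k l, fun w' hw' hc c hcST => ?_⟩
      rcases hcST with h | h
      · exact hk w' hw' (cylinder_anti w (le_max_left _ _) hc) c h
      · exact hl w' hw' (cylinder_anti w (le_max_right _ _) hc) c h
    · intro c _
      rw [nhdsWithin_univ]
      by_cases hc : res c σ.length = σ
      · obtain ⟨N, hN⟩ := hcl w hw c (hσ c hc)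
        exact ⟨_, cylinder_mem_nhds c N, N, fun w' hw' h c' hc' _ => hN w' hw' h c' hc'⟩
      · refine ⟨_, cylinder_mem_nhds c σ.length, 0, fun w' _ _ c' hc' h => absurd ?_ hc⟩
        rw [cylinder_eq_res] at hc'
        exact (show res c' σ.length = res c σ.length from hc') ▸ h
  obtain ⟨k, hk⟩ := this
  exact ⟨k, fun w' hw' hc c h => hk w' hw' hc c (Set.mem_univ _) h⟩

open Classical in
/-- The enumeration of the strings whose extension by `b` is excluded, at some stage, before the
extension by `!b`. The value `d` is enumerated at the idle stages. -/
noncomputable def exclusionSeq (D : Set (ℕ → ℕ)) (R : (ℕ → ℕ) → (ℕ → Bool) → Prop) (b : Bool)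
    (d : ℕ) (w : ℕ → ℕ) (t : ℕ) : ℕ :=
  let σ : List Bool := (Encodable.decode t.unpair.2).getD []
  if Excluded D R w (b :: σ) t.unpair.1 ∧ ¬ Excluded D R w ((!b) :: σ) t.unpair.1
    then Encodable.encode σ + 2 else d

theorem continuous_exclusionSeq (b : Bool) (d : ℕ) : Continuous (exclusionSeq D R b d) := by
  classical
  refine continuous_pi fun t => continuous_iff_continuousAt.2 fun w => ?_
  refine continuousAt_const.congr (f := fun _ => exclusionSeq D R b d w t) ?_
  filter_upwards [cylinder_mem_nhds w t.unpair.1] with w' hw'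
  exact if_congr (and_congr (excluded_congr hw').symm (not_congr (excluded_congr hw').symm)) rfl rfl

theorem exclusionSeq_pair {b : Bool} {d k : ℕ} (h : Excluded D R w (b :: σ) k)
    (h' : ¬ Excluded D R w ((!b) :: σ) k) :
    exclusionSeq D R b d w (Nat.pair k (Encodable.encode σ)) = Encodable.encode σ + 2 := by
  simp [exclusionSeq, h, h']

theorem exclusionSeq_eq (b : Bool) (d : ℕ) (w : ℕ → ℕ) (t : ℕ) :
    exclusionSeq D R b d w t = d ∨ ∃ (σ : List Bool) (k : ℕ), Excluded D R w (b :: σ) k ∧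
      ¬ Excluded D R w ((!b) :: σ) k ∧ exclusionSeq D R b d w t = Encodable.encode σ + 2 := by
  by_cases h : Excluded D R w (b :: (Encodable.decode t.unpair.2).getD []) t.unpair.1 ∧
      ¬ Excluded D R w ((!b) :: (Encodable.decode t.unpair.2).getD []) t.unpair.1
  · exact Or.inr ⟨_, _, h.1, h.2, if_pos h⟩
  · exact Or.inl (if_neg h)

theorem exclusionSeq_ne (w : ℕ → ℕ) (t u : ℕ) :
    exclusionSeq D R true 0 w t ≠ exclusionSeq D R false 1 w u := by
  rcases exclusionSeq_eq (D := D) (R := R) true 0 w t with h | ⟨σ, k, h1, h2, h⟩ <;>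
  rcases exclusionSeq_eq (D := D) (R := R) false 1 w u with h' | ⟨σ', k', h1', h2', h'⟩ <;>
  rw [h, h']
  · omega
  · omega
  · omega
  · intro heq
    obtain rfl : σ = σ' := Encodable.encode_injective (by omega)
    rcases le_total k k' with hk | hk
    · exact h2' (h1.mono hk)
    · exact h2 (h1'.mono hk)

/-- The (reversed) path through the binary tree along which `s` directs. -/
def pathPrefix (s : ℕ → ℕ) : ℕ → List Bool
  | 0 => []
  | n + 1 => decide (s (Encodable.encode (pathPrefix s n) + 2) ≠ 0) :: pathPrefix s n

/-- The infinite path along which `s` directs. -/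
def path (s : ℕ → ℕ) (n : ℕ) : Bool := decide (s (Encodable.encode (pathPrefix s n) + 2) ≠ 0)

theorem res_path (s : ℕ → ℕ) (n : ℕ) : res (path s) n = pathPrefix s n := by
  induction n with
  | zero => rfl
  | succ n ih => rw [res_succ, ih]; rfl

theorem eventually_apply_eq {X : Type*} [TopologicalSpace X] [DiscreteTopology X] (s : ℕ → X)
    (k : ℕ) : ∀ᶠ s' in 𝓝 s, s' k = s k :=
  (continuous_apply k).continuousAt.eventually (isOpen_discrete {s k} |>.mem_nhds rfl)

theorem continuous_path : Continuous path := by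
  have hp : ∀ s n, ∀ᶠ s' in 𝓝 s, pathPrefix s' n = pathPrefix s n := by
    intro s n
    induction n with
    | zero => exact Eventually.of_forall fun _ => rfl
    | succ n ih =>
      filter_upwards [ih, eventually_apply_eq s (Encodable.encode (pathPrefix s n) + 2)]
        with s' h1 h2
      rw [pathPrefix, pathPrefix, h1, h2]
  refine continuous_pi fun n => continuous_iff_continuousAt.2 fun s => ?_
  refine continuousAt_const.congr (f := fun _ => path s n) ?_
  filter_upwards [hp s n, eventually_apply_eq s (Encodable.encode (pathPrefix s n) + 2)]
    with s' h1 h2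
  rw [path, path, h1, h2]

/-- Separation solves closed problems with solutions in the Cantor space: the separating
sequences direct away from the strings that do not extend to a solution. -/
theorem path_of_separates (hne : ∀ w ∈ D, ∃ c, R w c)
    (hcl : ∀ w ∈ D, ∀ c, ¬ R w c → ∃ N, ∀ w' ∈ D, w' ∈ cylinder w N →
      ∀ c' ∈ cylinder (E := fun _ => Bool) c N, ¬ R w' c')
    (hw : w ∈ D) {s : ℕ → ℕ}
    (hs : ∀ t, s (exclusionSeq D R true 0 w t) = 0 ∧ s (exclusionSeq D R false 1 w t) = 1) :
    R w (path s) := by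
  have halive : ∀ n, ∃ c, res c n = pathPrefix s n ∧ R w c := by
    intro n
    induction n with
    | zero => exact (hne w hw).imp fun c hc => ⟨rfl, hc⟩
    | succ n ih =>
      obtain ⟨c, hc, hR⟩ := ih
      have hlen : (pathPrefix s n).length = n := by rw [← hc, res_length]
      by_contra hcon
      push Not at hcon
      -- If `s` directed to a string without solutions, the other successor would never be excluded,
      -- so the string would be enumerated on the side that forbids this direction.
      have hcn : c n ≠ path s n := fun h => hcon c (by rw [res_succ, hc, h]; rfl) hR
      have hcn' : c n = !path s n := by
        revert hcn
        cases c n <;> cases path s n <;> simp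
      obtain ⟨k, hk⟩ := exists_excluded (σ := path s n :: pathPrefix s n) hcl hw (by
        intro c' hc'
        rw [List.length_cons, hlen] at hc'
        exact hcon c' hc')
      have hnk : ¬ Excluded D R w ((!path s n) :: pathPrefix s n) k := fun h =>
        h w hw (self_mem_cylinder w k) c (by
          rw [List.length_cons, hlen, res_succ, hc, hcn']) hR
      have h1 := hs (Nat.pair k (Encodable.encode (pathPrefix s n)))
      cases hb : path s n
      · rw [hb] at hk hnk
        have h2 := h1.2
        rw [exclusionSeq_pair hk hnk] at h2
        simp [path, h2] at hb
      · rw [hb] at hk hnk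
        have h2 := h1.1
        rw [exclusionSeq_pair hk hnk] at h2
        simp [path, h2] at hb
  by_contra hcon
  obtain ⟨N, hN⟩ := hcl w hw _ hcon
  obtain ⟨c, hc, hR⟩ := halive N
  refine hN w hw (self_mem_cylinder w N) c ?_ hR
  rw [cylinder_eq_res]
  exact hc.trans (res_path s N).symm

end Choice

/-! ### Separation is not piecewise continuous -/

/-- The sequence whose `t`-th term is computed by `step t` from the earlier terms. -/
def recSeq {α : Type*} [Inhabited α] (step : ℕ → (ℕ → α) → α) : ℕ → α
  | t => step t fun u => if _ : u < t then recSeq step u else default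

theorem recSeq_eq {α : Type*} [Inhabited α] {step : ℕ → (ℕ → α) → α}
    (hstep : ∀ t x x', (∀ u < t, x u = x' u) → step t x = step t x') (t : ℕ) :
    recSeq step t = step t (recSeq step) := by
  rw [recSeq]
  exact hstep t _ _ fun u hu => by simp [hu]

/-- No countable family of continuous functions on pieces of the domain solves the separation
problem. A pair of sequences outside all pieces is built by diagonalization: as soon as a finite
part of it determines the value of the `i`-th function at `i + 2`, the number `i + 2` is enumerated
on the side that makes this value wrong. -/
theorem exists_disjoint_notMem_nat (E : ℕ → Set ((ℕ → ℕ) × (ℕ → ℕ)))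
    (φ : ℕ → (ℕ → ℕ) × (ℕ → ℕ) → ℕ → ℕ) (hφ : ∀ i, ContinuousOn (φ i) (E i))
    (hsep : ∀ i, ∀ pq ∈ E i, ∀ n, φ i pq (pq.1 n) = 0 ∧ φ i pq (pq.2 n) = 1) :
    ∃ pq : (ℕ → ℕ) × (ℕ → ℕ), (∀ n m, pq.1 n ≠ pq.2 m) ∧ ∀ i, pq ∉ E i := by
  classical
  let pr : (ℕ → ℕ × ℕ) → (ℕ → ℕ) × (ℕ → ℕ) := fun x => (fun t => (x t).1, fun t => (x t).2)
  have hpr : Continuous pr := by fun_prop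
  -- `Q i C v`: on `C`, the `i`-th function takes no other value at `i + 2` than `v`.
  let Q : ℕ → Set (ℕ → ℕ × ℕ) → ℕ → Prop := fun i C v =>
    ∀ x ∈ C, pr x ∈ E i → φ i (pr x) (i + 2) = v
  let used : ℕ → ℕ → (ℕ → ℕ × ℕ) → Prop := fun i t x =>
    ∃ u < t, (x u).1 = i + 2 ∨ (x u).2 = i + 2
  -- The numbers `0` and `1` are the idle values of the two sequences.
  let act : ℕ → ℕ → ℕ × ℕ := fun i v => if v = 0 then (0, i + 2) else (i + 2, 1)
  let C : ℕ → (ℕ → ℕ × ℕ) → Set (ℕ → ℕ × ℕ) := fun t x => cylinder (E := fun _ => ℕ × ℕ) x t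
  let step : ℕ → (ℕ → ℕ × ℕ) → ℕ × ℕ := fun t x =>
    if ¬ used t.unpair.1 t x ∧ ∃ v, Q t.unpair.1 (C t x) v
      then act t.unpair.1 (Classical.epsilon (Q t.unpair.1 (C t x))) else (0, 1)
  have hstep : ∀ t x x', (∀ u < t, x u = x' u) → step t x = step t x' := by
    intro t x x' h
    have hC : C t x = C t x' := mem_cylinder_iff_eq.1 h
    have hused : ∀ i, used i t x ↔ used i t x' := fun i =>
      exists_congr fun u => and_congr_right fun hu => by rw [h u hu]
    simp only [step, hC, hused]
  let x := recSeq step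
  have hx : ∀ t, x t = step t x := recSeq_eq hstep
  have hact : ∀ t, ¬ used t.unpair.1 t x → (∃ v, Q t.unpair.1 (C t x) v) →
      ∃ v, Q t.unpair.1 (C t x) v ∧ x t = act t.unpair.1 v := by
    intro t h1 h2
    exact ⟨_, Classical.epsilon_spec h2, (hx t).trans (if_pos ⟨h1, h2⟩)⟩
  have hcase : ∀ t, x t = (0, 1) ∨
      (¬ used t.unpair.1 t x ∧ ∃ v, Q t.unpair.1 (C t x) v ∧ x t = act t.unpair.1 v) := by
    intro t
    by_cases h : ¬ used t.unpair.1 t x ∧ ∃ v, Q t.unpair.1 (C t x) v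
    · exact Or.inr ⟨h.1, hact t h.1 h.2⟩
    · exact Or.inl ((hx t).trans (if_neg h))
  have hmark : ∀ i u, ((x u).1 = i + 2 ∨ (x u).2 = i + 2) →
      u.unpair.1 = i ∧ ¬ used i u x ∧ ∃ v, Q i (C u x) v ∧ x u = act i v := by
    intro i u hu
    rcases hcase u with h | ⟨h1, v, h2, h3⟩
    · rw [h] at hu
      simp at hu
    · have hi : u.unpair.1 = i := by
        rw [h3] at hu
        simp only [act] at hu
        split_ifs at hu <;> simp at hu <;> exact hu
      rw [hi] at h1 h2 h3
      exact ⟨hi, h1, v, h2, h3⟩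
  refine ⟨pr x, fun t u h => ?_, fun i hi => ?_⟩
  · replace h : (x t).1 = (x u).2 := h
    have hform : (x u).2 = 1 ∨ (x u).2 = u.unpair.1 + 2 := by
      rcases hcase u with h | ⟨-, v, -, h⟩ <;> rw [h]
      · exact Or.inl rfl
      · simp only [act]
        split_ifs <;> simp
    have hform' : (x t).1 = 0 ∨ (x t).1 = t.unpair.1 + 2 := by
      rcases hcase t with h | ⟨-, v, -, h⟩ <;> rw [h]
      · exact Or.inl rfl
      · simp only [act]
        split_ifs <;> simp
    obtain ⟨i, hi, hi'⟩ : ∃ i, (x t).1 = i + 2 ∧ (x u).2 = i + 2 :=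
      ⟨t.unpair.1, by omega, by omega⟩
    obtain ⟨-, h1, v, -, h2⟩ := hmark i t (Or.inl hi)
    obtain ⟨-, h1', v', -, h2'⟩ := hmark i u (Or.inr hi')
    rcases lt_trichotomy t u with hlt | rfl | hlt
    · exact h1' ⟨t, hlt, Or.inl hi⟩
    · rw [h2] at hi hi'
      simp only [act] at hi hi'
      split_ifs at hi hi'
      exact absurd hi' (by simp)
    · exact h1 ⟨u, hlt, Or.inr hi'⟩
  · -- The value of the `i`-th function at `i + 2` is determined by some finite part of `x`.
    have hev : ∀ᶠ pq in 𝓝[E i] pr x, φ i pq (i + 2) = φ i (pr x) (i + 2) :=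
      (hφ i _ hi).eventually (eventually_apply_eq _ _)
    rw [eventually_nhdsWithin_iff] at hev
    obtain ⟨N, hN⟩ := exists_cylinder_subset (hpr.continuousAt.eventually hev)
    have hQ : Q i (C (Nat.pair i N) x) (φ i (pr x) (i + 2)) := fun x' hx' hE =>
      hN (cylinder_anti x (Nat.right_le_pair i N) hx') hE
    obtain ⟨u, v, hv, hu⟩ : ∃ u v, Q i (C u x) v ∧ x u = act i v := by
      by_cases h : used i (Nat.pair i N) x
      · obtain ⟨u, -, hu⟩ := h
        obtain ⟨-, -, v, h1, h2⟩ := hmark i u hu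
        exact ⟨u, v, h1, h2⟩
      · have h1 := hact (Nat.pair i N)
        rw [Nat.unpair_pair] at h1
        obtain ⟨v, h2, h3⟩ := h1 h ⟨_, hQ⟩
        exact ⟨_, v, h2, h3⟩
    have hval := hv x (self_mem_cylinder x u) hi
    have hs := hsep i _ hi u
    simp only [pr, hu, act] at hs
    split_ifs at hs with h0
    · have := hs.2.symm.trans hval
      omega
    · exact h0 (hval.symm.trans hs.1)

theorem exists_disjoint_notMem {ι : Type*} [Countable ι] (E : ι → Set ((ℕ → ℕ) × (ℕ → ℕ)))
    (φ : ι → (ℕ → ℕ) × (ℕ → ℕ) → ℕ → ℕ) (hφ : ∀ i, ContinuousOn (φ i) (E i))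
    (hsep : ∀ i, ∀ pq ∈ E i, ∀ n, φ i pq (pq.1 n) = 0 ∧ φ i pq (pq.2 n) = 1) :
    ∃ pq : (ℕ → ℕ) × (ℕ → ℕ), (∀ n m, pq.1 n ≠ pq.2 m) ∧ ∀ i, pq ∉ E i := by
  rcases isEmpty_or_nonempty ι with h | h
  · exact ⟨(fun _ => 0, fun _ => 1), fun _ _ => zero_ne_one, fun i => h.elim i⟩
  · obtain ⟨e, he⟩ := exists_surjective_nat ι
    obtain ⟨pq, h1, h2⟩ := exists_disjoint_notMem_nat (fun n => E (e n)) (fun n => φ (e n))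
      (fun n => hφ _) (fun n => hsep _)
    exact ⟨pq, h1, fun i => (he i).elim fun n hn => hn ▸ h2 n⟩

/-! ### The reductions -/

open Classical in
/-- A partial function, continued by a default value. -/
noncomputable def extend {X Y : Type*} [Inhabited Y] (f : X →. Y) (x : X) : Y :=
  if h : (f x).Dom then (f x).get h else default

theorem extend_eq {X Y : Type*} [Inhabited Y] {f : X →. Y} {x : X} {y : Y} (h : y ∈ f x) :
    extend f x = y := by
  obtain ⟨h1, h2⟩ := h
  rw [extend, dif_pos h1, h2]

theorem PartialContinuous.continuousOn {X Y : Type*} [TopologicalSpace X] [TopologicalSpace Y]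
    [Inhabited Y] {f : X →. Y} (h : PartialContinuous f) : ContinuousOn (extend f) f.Dom := by
  rw [continuousOn_iff_continuous_domRestrict]
  have : f.Dom.domRestrict (extend f) = f.asSubtype := funext fun x => extend_eq ⟨x.2, rfl⟩
  rw [this]
  exact h

theorem partialContinuous_res {X Y : Type*} [TopologicalSpace X] [TopologicalSpace Y] {f : X → Y}
    {S : Set X} (h : ContinuousOn f S) : PartialContinuous (PFun.res f S) :=
  continuousOn_iff_continuous_domRestrict.1 h

theorem isClosed_isNashEquilibrium (n m : ℕ) :
    IsClosed {q : Matrix (Fin n) (Fin m) ℝ × Matrix (Fin n) (Fin m) ℝ × (Fin n → ℝ) × (Fin m → ℝ) |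
      IsNashEquilibrium q.1 q.2.1 q.2.2.1 q.2.2.2} := by
  simp only [IsNashEquilibrium, Set.ofPred_and, Set.ofPred_forall]
  refine ((isClosed_stdSimplex ℝ _).preimage (by fun_prop)).inter
    (((isClosed_stdSimplex ℝ _).preimage (by fun_prop)).inter
    ((isClosed_biInter fun x' _ => ?_).inter (isClosed_biInter fun y' _ => ?_)))
  · exact isClosed_le (by fun_prop) (by fun_prop)
  · exact isClosed_le (by fun_prop) (by fun_prop)

/-- The names of games of all sizes. -/
def allGameNames (ν : ℕ → ℚ) : Set (ℕ → ℕ) :=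
  {w | ∃ n m : ℕ, 0 < n ∧ 0 < m ∧ w ∈ gameNames ν n m}

/-- The pairs of strategies, together with names of them, form a continuous image of the Cantor
space. -/
theorem exists_continuous_param {ν : ℕ → ℚ} (hν : Function.Surjective ν) (n m : ℕ) :
    ∃ (x : (ℕ → Bool) → Fin n → ℝ) (y : (ℕ → Bool) → Fin m → ℝ) (o : (ℕ → Bool) → ℕ → ℕ),
      Continuous x ∧ Continuous y ∧ Continuous o ∧
      (∀ c, IsStrategyPairName ν (o c) (x c) (y c)) ∧
      (0 < n → 0 < m → ∀ a ∈ stdSimplex ℝ (Fin n), ∀ b ∈ stdSimplex ℝ (Fin m),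
        ∃ c, x c = a ∧ y c = b) := by
  have key : ∃ (x : (ℕ → Bool) → Fin n → ℝ) (y : (ℕ → Bool) → Fin m → ℝ),
      Continuous x ∧ Continuous y ∧
      (0 < n → 0 < m → ∀ a ∈ stdSimplex ℝ (Fin n), ∀ b ∈ stdSimplex ℝ (Fin m),
        ∃ c, x c = a ∧ y c = b) := by
    by_cases h : 0 < n ∧ 0 < m
    · have : Nonempty (Fin n) := ⟨⟨0, h.1⟩⟩
      have : Nonempty (Fin m) := ⟨⟨0, h.2⟩⟩
      have : CompactSpace (stdSimplex ℝ (Fin n)) :=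
        isCompact_iff_compactSpace.1 (isCompact_stdSimplex ℝ _)
      have : CompactSpace (stdSimplex ℝ (Fin m)) :=
        isCompact_iff_compactSpace.1 (isCompact_stdSimplex ℝ _)
      obtain ⟨f, hf, hsurj⟩ := exists_nat_bool_continuous_surjective_of_compact
        (stdSimplex ℝ (Fin n) × stdSimplex ℝ (Fin m))
      refine ⟨fun c => (f c).1.1, fun c => (f c).2.1, by fun_prop, by fun_prop,
        fun _ _ a ha b hb => ?_⟩
      obtain ⟨c, hc⟩ := hsurj (⟨a, ha⟩, ⟨b, hb⟩)
      exact ⟨c, by simp only [hc], by simp only [hc]⟩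
    · exact ⟨fun _ => 0, fun _ => 0, continuous_const, continuous_const,
        fun hn hm => absurd ⟨hn, hm⟩ h⟩
  obtain ⟨x, y, hx, hy, hsurj⟩ := key
  obtain ⟨o, ho, hname⟩ := exists_continuousOn_isStrategyPairName hν (S := Set.univ)
    hx.continuousOn hy.continuousOn
  exact ⟨x, y, o, hx, hy, continuousOn_univ.1 ho, fun c => hname c trivial, hsurj⟩

/-- The relation between names of games and points of the Cantor space that parametrize equilibria
is closed with nonempty sections, so separation finds an equilibrium. -/
theorem nash_le_sep {ν : ℕ → ℚ} (hν : Function.Surjective ν) : Type2Reducible (Nash ν) Sep := by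
  classical
  choose x y o hx hy ho hname hsurj using exists_continuous_param hν
  choose A B hA hB hAB using exists_continuousOn_game ν
  let D := allGameNames ν
  let R : (ℕ → ℕ) → (ℕ → Bool) → Prop := fun w c => ∀ n m, 0 < n → 0 < m →
    ∀ A B : Matrix (Fin n) (Fin m) ℝ, IsGameName ν w A B → IsNashEquilibrium A B (x n m c) (y n m c)
  have hne : ∀ w ∈ D, ∃ c, R w c := by
    rintro w ⟨n, m, hn, hm, hw⟩
    obtain ⟨a, b, hab⟩ := exists_isNashEquilibrium hn hm (A n m w) (B n m w)
    obtain ⟨c, rfl, rfl⟩ := hsurj n m hn hm a hab.1 b hab.2.1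
    refine ⟨c, fun n' m' hn' hm' A' B' h => ?_⟩
    obtain ⟨rfl, rfl⟩ := size_eq_of_gameNames hm hm' hw ⟨A', B', h⟩ (self_mem_cylinder _ _)
    obtain ⟨rfl, rfl⟩ := h.unique (hAB _ _ w hw)
    exact hab
  have hcl : ∀ w ∈ D, ∀ c, ¬ R w c → ∃ N, ∀ w' ∈ D, w' ∈ cylinder w N →
      ∀ c' ∈ cylinder (E := fun _ => Bool) c N, ¬ R w' c' := by
    intro w _ c hR
    simp only [R] at hR
    push Not at hR
    obtain ⟨n, m, hn, hm, A', B', h, hnot⟩ := hR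
    have hw : w ∈ gameNames ν n m := ⟨A', B', h⟩
    obtain ⟨rfl, rfl⟩ := h.unique (hAB _ _ w hw)
    have hcont : Tendsto (fun p : (ℕ → ℕ) × (ℕ → Bool) =>
        (A n m p.1, B n m p.1, x n m p.2, y n m p.2)) (𝓝[gameNames ν n m] w ×ˢ 𝓝 c)
        (𝓝 (A n m w, B n m w, x n m c, y n m c)) :=
      ((hA n m w hw).tendsto.comp tendsto_fst).prodMk_nhds
        (((hB n m w hw).tendsto.comp tendsto_fst).prodMk_nhds
          ((((hx n m).tendsto c).comp tendsto_snd).prodMk_nhds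
            (((hy n m).tendsto c).comp tendsto_snd)))
    have hev := hcont.eventually
      ((isClosed_isNashEquilibrium n m).isOpen_compl.mem_nhds (by simpa using hnot))
    obtain ⟨U, hU, V, hV, hUV⟩ := eventually_prod_iff.1 hev
    obtain ⟨N₁, hN₁⟩ := exists_cylinder_of_mem_nhdsWithin hU
    obtain ⟨N₂, hN₂⟩ := exists_cylinder_subset hV
    refine ⟨max (n + m + 1) (max N₁ N₂), fun w' hw' hcyl c' hc' hR' => ?_⟩
    obtain ⟨n', m', hn', hm', hw''⟩ := hw'
    obtain ⟨rfl, rfl⟩ := size_eq_of_gameNames hm hm' hw hw''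
      (cylinder_anti w (le_max_left _ _) hcyl)
    exact hUV (hN₁ w' hw'' (cylinder_anti w ((le_max_left _ _).trans (le_max_right _ _)) hcyl))
      (hN₂ (cylinder_anti c ((le_max_right _ _).trans (le_max_right _ _)) hc'))
      (hR' n' m' hn' hm' _ _ (hAB _ _ w' hw''))
  -- The size of the game is a locally constant function of the name.
  have hsz : ∀ w, ∃ k : ℕ × ℕ, w ∈ D → 0 < k.1 ∧ 0 < k.2 ∧ w ∈ gameNames ν k.1 k.2 := by
    intro w
    by_cases h : w ∈ D
    · obtain ⟨n, m, h'⟩ := h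
      exact ⟨(n, m), fun _ => h'⟩
    · exact ⟨(0, 0), fun h' => absurd h' h⟩
  choose sz hsz using hsz
  have hszc : ContinuousOn sz D := by
    intro w hw
    refine continuousWithinAt_const.congr_of_eventuallyEq (f := fun _ => sz w) ?_ rfl
    filter_upwards [self_mem_nhdsWithin,
      mem_nhdsWithin_of_mem_nhds (cylinder_mem_nhds w ((sz w).1 + (sz w).2 + 1))] with w' hw' hc
    obtain ⟨h1, h2⟩ := size_eq_of_gameNames (hsz w hw).2.1 (hsz w' hw').2.1 (hsz w hw).2.2
      (hsz w' hw').2.2 hc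
    exact Prod.ext h1 h2
  have hO : Continuous fun q : (ℕ × ℕ) × (ℕ → Bool) => o q.1.1 q.1.2 q.2 :=
    continuous_prod_of_discrete_left.2 fun k => ho k.1 k.2
  let F : (ℕ → ℕ) × (ℕ → ℕ) → ℕ → ℕ := fun p => o (sz p.1).1 (sz p.1).2 (path p.2)
  let G : (ℕ → ℕ) → (ℕ → ℕ) × (ℕ → ℕ) := fun w =>
    (exclusionSeq D R true 0 w, exclusionSeq D R false 1 w)
  have hF : ContinuousOn F (D ×ˢ Set.univ) :=
    hO.comp_continuousOn ((hszc.comp continuousOn_fst fun p hp => hp.1).prodMk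
      (continuous_path.comp continuous_snd).continuousOn)
  have hG : Continuous G := (continuous_exclusionSeq _ _).prodMk (continuous_exclusionSeq _ _)
  refine ⟨PFun.res F (D ×ˢ Set.univ), PFun.res G Set.univ, partialContinuous_res hF,
    partialContinuous_res hG.continuousOn, fun g hg => ?_⟩
  have hmem : ∀ w v, v ∈ sandwich (PFun.res F (D ×ˢ Set.univ)) (PFun.res G Set.univ) g w ↔
      ∃ s ∈ g (G w), w ∈ D ∧ F (w, s) = v := by
    intro w v
    simp only [sandwich, Part.mem_bind_iff, PFun.mem_res, Set.mem_univ, true_and, exists_eq_left',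
      Set.mem_prod, and_true]
  constructor
  · ext w
    simp only [PFun.mem_dom, hmem, Set.mem_ofPred_eq]
    constructor
    · rintro ⟨v, s, -, hw, -⟩
      exact hw
    · intro hw
      have : G w ∈ g.Dom := by
        rw [hg.1]
        exact exclusionSeq_ne w
      obtain ⟨s, hs⟩ := PFun.mem_dom _ _ |>.1 this
      exact ⟨_, s, hs, hw, rfl⟩
  · intro n m hn hm A' B' w h v hv
    obtain ⟨s, hs, hw, rfl⟩ := (hmem w v).1 hv
    obtain ⟨h1, h2⟩ := size_eq_of_gameNames hm (hsz w hw).2.1 ⟨A', B', h⟩ (hsz w hw).2.2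
      (self_mem_cylinder _ _)
    refine ⟨x n m (path s), y n m (path s),
      path_of_separates hne hcl hw (hg.2 _ _ s hs) n m hn hm A' B' h, ?_⟩
    simp only [F, h1, h2]
    exact hname n m _

/-- The games of a fixed size fall into finitely many pieces on which names of Nash equilibria can
be computed continuously from names of the games. -/
theorem exists_piecewise_continuous_nash {ν : ℕ → ℚ} (hν : Function.Surjective ν) {n m : ℕ}
    (hn : 0 < n) (hm : 0 < m) :
    ∃ (E : Finset (Fin n ⊕ Fin m) × Finset (Fin n ⊕ Fin m) → Set (ℕ → ℕ))
      (φ : Finset (Fin n ⊕ Fin m) × Finset (Fin n ⊕ Fin m) → (ℕ → ℕ) → ℕ → ℕ),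
      (∀ p, ContinuousOn (φ p) (E p)) ∧ (∀ w ∈ gameNames ν n m, ∃ p, w ∈ E p) ∧
      ∀ p, ∀ w ∈ E p, ∃ A B : Matrix (Fin n) (Fin m) ℝ, IsGameName ν w A B ∧
        ∃ x y, IsNashEquilibrium A B x y ∧ IsStrategyPairName ν (φ p w) x y := by
  have := nontrivial_fin_sum hn hm
  obtain ⟨A, B, hA, hB, hAB⟩ := exists_continuousOn_game ν n m
  obtain ⟨E, z, hE, hzc, hz⟩ :=
    exists_piecewise_continuous_isSymmetricEquilibrium (Fin n ⊕ Fin m)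
  let S : (ℕ → ℕ) → Matrix (Fin n ⊕ Fin m) (Fin n ⊕ Fin m) ℝ := fun w => symmetrization (A w) (B w)
  have hsym : Continuous fun q : Matrix (Fin n) (Fin m) ℝ × Matrix (Fin n) (Fin m) ℝ =>
      symmetrization q.1 q.2 := by
    have hs : Continuous fun q : Matrix (Fin n) (Fin m) ℝ × Matrix (Fin n) (Fin m) ℝ =>
        payoffShift q.1 q.2 := by
      unfold payoffShift
      fun_prop
    refine Continuous.matrix_fromBlocks continuous_const ?_ ?_ continuous_const
    · exact continuous_matrix fun i j => by
        simp only [Matrix.of_apply]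
        fun_prop
    · exact continuous_matrix fun j i => by
        simp only [Matrix.of_apply]
        fun_prop
  have hS : ContinuousOn S (gameNames ν n m) := hsym.comp_continuousOn (hA.prodMk hB)
  let E' : Finset (Fin n ⊕ Fin m) × Finset (Fin n ⊕ Fin m) → Set (ℕ → ℕ) := fun p =>
    {w | w ∈ gameNames ν n m ∧ S w ∈ E p}
  have hzS : ∀ p, ContinuousOn (fun w => z (S w)) (E' p) := fun p =>
    (hzc p).comp (hS.mono fun w hw => hw.1) fun w hw => hw.2
  have hzk : ∀ p k, ContinuousOn (fun w => z (S w) k) (E' p) := fun p k =>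
    continuousOn_pi.1 (hzS p) k
  have hx : ∀ p, ContinuousOn (fun w i => z (S w) (Sum.inl i) / ∑ i, z (S w) (Sum.inl i)) (E' p) :=
    fun p => continuousOn_pi.2 fun i => (hzk p _).div
      (continuousOn_finsetSum _ fun i _ => hzk p _) fun w _ => ((hz (S w)).sum_inl_pos hn).ne'
  have hy : ∀ p, ContinuousOn (fun w j => z (S w) (Sum.inr j) / ∑ j, z (S w) (Sum.inr j)) (E' p) :=
    fun p => continuousOn_pi.2 fun j => (hzk p _).div
      (continuousOn_finsetSum _ fun j _ => hzk p _) fun w _ => ((hz (S w)).sum_inr_pos hm).ne'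
  choose φ hφ hname using fun p => exists_continuousOn_isStrategyPairName hν (hx p) (hy p)
  exact ⟨E', φ, hφ, fun w hw => (hE (S w)).imp fun p hp => ⟨hw, hp⟩, fun p w hw =>
    ⟨A w, B w, hAB w hw.1, _, _, (hz (S w)).isNashEquilibrium hn hm, hname p w hw⟩⟩

/-- For the choice function of `Nash` given by the continuous pieces, a reduction would solve
separation continuously on countably many pieces. -/
theorem not_sep_le_nash {ν : ℕ → ℚ} (hν : Function.Surjective ν) :
    ¬ Type2Reducible Sep (Nash ν) := by
  classical
  rintro ⟨F, G, hF, hG, hFG⟩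
  choose E φ hφ hcov hE using
    fun q : {q : ℕ × ℕ // 0 < q.1 ∧ 0 < q.2} => exists_piecewise_continuous_nash hν q.2.1 q.2.2
  let ι := Σ q : {q : ℕ × ℕ // 0 < q.1 ∧ 0 < q.2},
    Finset (Fin q.1.1 ⊕ Fin q.1.2) × Finset (Fin q.1.1 ⊕ Fin q.1.2)
  have hpiece : ∀ w, ∃ k : ι, w ∈ allGameNames ν → w ∈ E k.1 k.2 := by
    intro w
    by_cases h : w ∈ allGameNames ν
    · obtain ⟨n, m, hn, hm, hw⟩ := h
      obtain ⟨p, hp⟩ := hcov ⟨(n, m), hn, hm⟩ w hw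
      exact ⟨⟨_, p⟩, fun _ => hp⟩
    · exact ⟨⟨⟨(1, 1), one_pos, one_pos⟩, ∅, ∅⟩, fun h' => absurd h' h⟩
  choose k hk using hpiece
  let g : (ℕ → ℕ) →. (ℕ → ℕ) := PFun.res (fun w => φ (k w).1 (k w).2 w) (allGameNames ν)
  have hg : g ∈ Nash ν := by
    refine ⟨rfl, fun n m hn hm A B w h v hv => ?_⟩
    obtain ⟨hw, rfl⟩ := (PFun.mem_res _ _ _ _).1 hv
    obtain ⟨A', B', h', x, y, hxy, hname⟩ := hE (k w).1 (k w).2 w (hk w hw)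
    generalize φ (k w).1 (k w).2 w = v at hname
    revert A' B' x y
    obtain ⟨⟨⟨n', m'⟩, hn', hm'⟩, p⟩ := k w
    intro A' B' h' x y hxy hname
    obtain ⟨rfl, rfl⟩ := size_eq_of_gameNames hm hm' ⟨A, B, h⟩ ⟨A', B', h'⟩ (self_mem_cylinder _ _)
    obtain ⟨rfl, rfl⟩ := h.unique h'
    exact ⟨x, y, hxy, hname⟩
  obtain ⟨hdom, hsol⟩ := hFG g hg
  have hdef : ∀ pq : (ℕ → ℕ) × (ℕ → ℕ), (∀ n m, pq.1 n ≠ pq.2 m) → pq ∈ G.Dom ∧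
      extend G pq ∈ allGameNames ν ∧
      (pq, φ (k (extend G pq)).1 (k (extend G pq)).2 (extend G pq)) ∈ F.Dom ∧
      ∀ n, extend F (pq, φ (k (extend G pq)).1 (k (extend G pq)).2 (extend G pq)) (pq.1 n) = 0 ∧
        extend F (pq, φ (k (extend G pq)).1 (k (extend G pq)).2 (extend G pq)) (pq.2 n) = 1 := by
    intro pq hpq
    have hmem : pq ∈ (sandwich F G g).Dom := by
      rw [hdom]
      exact hpq
    obtain ⟨s, hs⟩ := PFun.mem_dom _ _ |>.1 hmem
    have hs' := hs
    simp only [sandwich, Part.mem_bind_iff] at hs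
    obtain ⟨u, hu, v, hv, hF'⟩ := hs
    obtain ⟨huD, rfl⟩ := (PFun.mem_res _ _ _ _).1 hv
    rw [extend_eq hu, extend_eq hF']
    exact ⟨PFun.mem_dom _ _ |>.2 ⟨u, hu⟩, huD, PFun.mem_dom _ _ |>.2 ⟨s, hF'⟩,
      hsol pq.1 pq.2 s hs'⟩
  obtain ⟨pq, hpq, hnot⟩ := exists_disjoint_notMem
    (fun i : ι => {pq | (∀ n m, pq.1 n ≠ pq.2 m) ∧ k (extend G pq) = i})
    (fun i pq => extend F (pq, φ i.1 i.2 (extend G pq)))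
    (fun i => by
      refine hF.continuousOn.comp (continuousOn_id.prodMk ((hφ i.1 i.2).comp
        (hG.continuousOn.mono fun pq hpq => (hdef pq hpq.1).1) ?_)) ?_
      · rintro pq ⟨hpq, rfl⟩
        exact hk _ (hdef pq hpq).2.1
      · rintro pq ⟨hpq, rfl⟩
        exact (hdef pq hpq).2.2.1)
    (by
      rintro i pq ⟨hpq, rfl⟩
      exact (hdef pq hpq).2.2.2)
  exact hnot _ ⟨hpq, rfl⟩

end NashSep

theorem corollary38 (ν : ℕ → ℚ) (hν : Function.Bijective ν) :
    NashSep.StrictlyType2Reducible (NashSep.Nash ν) NashSep.Sep :=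
  ⟨NashSep.nash_le_sep hν.surjective, NashSep.not_sep_le_nash hν.surjective⟩
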